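/- Let $G=(V,E)$ be a chain graph: a finite graph with undirected and directed edges and no semi-directed cycle. Its chain components $T\in\mathcal T$ are the connected components left after removing the directed edges. Let $\prec$ be a consistent strict total order of the components, i.e. if $T\prec T'$ then no directed edge points from $T$ to $T'$; put $\mathrm{pre}(T)=\bigcup_{T\prec T'}T'$, and let $\mathrm{pa}_G(A)$ be the set of nodes $w\notin A$ with $w\to v$ for some $v\in A$. A set $A\subseteq T$ is connected if any two of its nodes are joined by a path inside $A$, and disconnected otherwise. Let $X=(X_v)_{v\in V}$ be discrete, $X_v$ having levels $1,\dots,r_v$ ($r_v\ge 1$), with $\mathcal I_B=\prod_{v\in B}\{1,\dots,r_v\}$, $\mathcal I_B^\star=\prod_{v\in B}\{2,\dots,r_v\}$ and $\mathcal I=\mathcal I_V$. The model $\mathbf P_{\mathrm{MR}}(G)$ is the set of strictly positive distributions $p$ on $\mathcal I$ such that for all $T\in\mathcal T$ and $A\subseteq T$: if $A$ is connected, then $A\perp\!\!\!\perp[\mathrm{pre}(T)\setminus\mathrm{pa}_G(A)]\mid\mathrm{pa}_G(A)$; if $A$ is disconnected with connected components $A_1,\dots,A_k$, then $A_1\perp\!\!\!\perp\cdots\perp\!\!\!\perp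 A_k\mid\mathrm{pre}(T)$. For strictly positive $p$, $\emptyset\ne A\subseteq T$, $i_A^\star\in\mathcal I_A^\star$ and $i_{\mathrm{pre}(T)}\in\mathcal I_{\mathrm{pre}(T)}$, put $$\eta^{(A)}(i_A^\star\mid i_{\mathrm{pre}(T)})=\sum_{s\subseteq A}(-1)^{|A\setminus s|}\log p(i_s^\star,1_{A\setminus s}\mid i_{\mathrm{pre}(T)}),$$ and consider the saturated regression $$\eta^{(A)}(i_A^\star\mid i_{\mathrm{pre}(T)})=\sum_{b\subseteq\mathrm{pre}(T)}\beta_b^{(A)}(i_A^\star,i_b),$$ where $\beta_b^{(A)}(i_A^\star,i_b)=0$ whenever some coordinate of $i_b$ is $1$ (baseline coding). Then: 1. Every strictly positive $p$ has exactly one such family $\beta$. 2. A strictly positive $p$ belongs to $\mathbf P_{\mathrm{MR}}(G)$ if and only if, for all $T\in\mathcal T$ and all nonempty $A\subseteq T$, $\beta_b^{(A)}$ vanishes identically whenever (i) $A$ is connected, $b\subseteq\mathrm{pre}(T)$ and $b\not\subseteq\mathrm{pa}_G(A)$, or (ii) $A$ is disconnected and $b\subseteq\mathrm{pre}(T)$.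 3. Write the strictly positive distributions as the exponential family with natural parameters $\theta_i=\log\bigl(p(i)/p(1,\dots,1)\bigr)$, $i\in\mathcal I\setminus\{(1,\dots,1)\}$. The map from $\theta$ to the coordinates $\beta^{(A)}_b(i_A^\star,i_b^\star)$ with $i_b^\star\in\mathcal I_b^\star$ is a $C^\infty$ diffeomorphism onto an open set, and $\mathbf P_{\mathrm{MR}}(G)$ consists of the distributions for which the coordinates listed in (i) and (ii) are $0$. Hence $\mathbf P_{\mathrm{MR}}(G)$ is defined by linear constraints in a multivariate logistic parameterization and is a curved exponential family, i.e. its set of natural parameters is an embedded smooth submanifold of the natural parameter space. -/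

import Mathlib

open scoped ContDiff

/-- A chain graph: undirected edges `undir`, directed edges `dir`, and no semi-directed cycle,
i.e. no closed path that contains a directed edge and traverses all its directed edges forwards. -/
structure ChainGraph (V : Type*) where
  undir : SimpleGraph V
  dir : V → V → Prop
  no_semidirected_cycle : ∀ v w, dir v w →
    ¬ Relation.ReflTransGen (fun a b => undir.Adj a b ∨ dir a b) w v

namespace ChainGraph

variable {V : Type*} [Fintype V] [DecidableEq V] (G : ChainGraph V)

/-- The chain components: connected components after removal of the directed edges. -/
abbrev Component {V : Type*} (G : ChainGraph V) : Type _ := G.undir.ConnectedComponent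

open scoped Classical in
/-- The node set of a chain component. -/
noncomputable def nodes (T : G.Component) : Finset V :=
  Finset.univ.filter fun v => G.undir.connectedComponentMk v = T

/-- `T₁ ⟶ T₂` in the directed graph of chain components. -/
def CompArrow {V : Type*} (G : ChainGraph V) (T₁ T₂ : G.Component) : Prop :=
  ∃ v w, G.undir.connectedComponentMk v = T₁ ∧ G.undir.connectedComponentMk w = T₂ ∧ G.dir v w

open scoped Classical in
/-- The parents of a set of nodes. -/
noncomputable def parents (A : Finset V) : Finset V :=
  Finset.univ.filter fun w => w ∉ A ∧ ∃ v ∈ A, G.dir w v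

/-- `A` is connected: any two nodes of `A` are joined by a path inside `A`. It is used for subsets
of chain components, where all edges are undirected. -/
def IsConn {V : Type*} (G : ChainGraph V) (A : Finset V) : Prop :=
  (G.undir.induce (A : Set V)).Preconnected

/-- `v` and `w` are joined by a path inside `A`. -/
def JoinedIn {V : Type*} (G : ChainGraph V) (A : Finset V) (v w : V) : Prop :=
  ∃ (hv : v ∈ (A : Set V)) (hw : w ∈ (A : Set V)),
    (G.undir.induce (A : Set V)).Reachable ⟨v, hv⟩ ⟨w, hw⟩

open scoped Classical in
/-- The node sets of the connected components `A₁, …, A_r` of `A`. -/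
noncomputable def pieces (A : Finset V) : Finset (Finset V) :=
  A.image fun v => A.filter fun w => G.JoinedIn A v w

/-- A strict total order `≺` of the chain components that is consistent with the graph: if
`T ≺ T'` then `T` is not a parent component of `T'` (so the past of `T` consists of the `T'`
with `T ≺ T'`). -/
structure ConsistentOrder {V : Type*} (G : ChainGraph V) where
  prec : G.Component → G.Component → Prop
  irrefl : ∀ T, ¬ prec T T
  trans : ∀ T₁ T₂ T₃, prec T₁ T₂ → prec T₂ T₃ → prec T₁ T₃
  total : ∀ T₁ T₂, T₁ ≠ T₂ → prec T₁ T₂ ∨ prec T₂ T₁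
  consistent : ∀ T T', prec T T' → ¬ G.CompArrow T T'

variable {G}

open scoped Classical in
/-- `pre(T)`, the union of all components `T'` with `T ≺ T'`. -/
noncomputable def ConsistentOrder.pre (o : G.ConsistentOrder) (T : G.Component) : Finset V :=
  Finset.univ.filter fun v => o.prec T (G.undir.connectedComponentMk v)

end ChainGraph

section Tables

variable {V : Type*} [Fintype V] [DecidableEq V] (r : V → ℕ)

/-- The cells of the contingency table; `X_v` has `r v` levels, the first of which is `0`. -/
abbrev Cell {V : Type*} (r : V → ℕ) : Type _ := ∀ v, Fin (r v)

/-- The cells of the marginal table `B`. -/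
abbrev SubCell {V : Type*} (r : V → ℕ) (B : Finset V) : Type _ := ∀ v : {v // v ∈ B}, Fin (r v)

/-- The cells of the marginal table `A` all of whose indices differ from the first level. -/
abbrev StarCell {V : Type*} (r : V → ℕ) [∀ v, NeZero (r v)] (A : Finset V) : Type _ :=
  ∀ v : {v // v ∈ A}, {x : Fin (r v) // x ≠ 0}

variable {r}

/-- Strictly positive probability mass functions. -/
def IsPositiveDist (p : Cell r → ℝ) : Prop := (∀ i, 0 < p i) ∧ ∑ i, p i = 1

/-- The marginal probability `p(i_B)`; it depends on the coordinates of `i` in `B` only. -/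
noncomputable def marg (p : Cell r → ℝ) (B : Finset V) (i : Cell r) : ℝ :=
  ∑ j ∈ Finset.univ.filter (fun j : Cell r => ∀ v ∈ B, j v = i v), p j

/-- The conditional probability `p(i_A | i_B)`. -/
noncomputable def condProb (p : Cell r → ℝ) (A B : Finset V) (i : Cell r) : ℝ :=
  marg p (A ∪ B) i / marg p B i

/-- `A ⊥⊥ B | C`. -/
def CondIndep (p : Cell r → ℝ) (A B C : Finset V) : Prop :=
  ∀ i, marg p (A ∪ B ∪ C) i * marg p C i = marg p (A ∪ C) i * marg p (B ∪ C) i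

/-- Joint conditional independence given `C` of the (disjoint) sets in `S`. -/
def MutualCondIndep (p : Cell r → ℝ) (S : Finset (Finset V)) (C : Finset V) : Prop :=
  ∀ i, condProb p (S.biUnion id) C i = ∏ K ∈ S, condProb p K C i

/-- The multivariate regression Markov property. -/
def MRMarkov (G : ChainGraph V) (o : G.ConsistentOrder) (p : Cell r → ℝ) : Prop :=
  ∀ (T : G.Component) (A : Finset V), A ⊆ G.nodes T →
    (G.IsConn A → CondIndep p A (o.pre T \ G.parents A) (G.parents A)) ∧
    (¬ G.IsConn A → MutualCondIndep p (G.pieces A) (o.pre T))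

/-- The discrete multivariate regression chain graph model. -/
def modelMR (G : ChainGraph V) (o : G.ConsistentOrder) (r : V → ℕ) : Set (Cell r → ℝ) :=
  {p | IsPositiveDist p ∧ MRMarkov G o p}

variable [∀ v, NeZero (r v)]

/-- A cell with coordinates `i_s^*` on `s ⊆ A`, the first level on `A \ s`, and `i_B` on `B`
(`A` and `B` disjoint); the other coordinates are irrelevant where it is used. -/
def glue {A B : Finset V} (s : Finset V) (iA : StarCell r A) (iB : SubCell r B) : Cell r :=
  fun v => if hA : v ∈ A then (if v ∈ s then (iA ⟨v, hA⟩ : Fin (r v)) else 0)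
    else if hB : v ∈ B then iB ⟨v, hB⟩ else 0

/-- The multivariate logistic contrast `η^{(A)}(i_A^* | i_B)` of the conditional
distribution given `X_B = i_B`. -/
noncomputable def logisticContrast (p : Cell r → ℝ) (A B : Finset V)
    (iA : StarCell r A) (iB : SubCell r B) : ℝ :=
  ∑ s ∈ A.powerset, (-1 : ℝ) ^ (A \ s).card * Real.log (condProb p A B (glue s iA iB))

/-- Indices of the regression parameters `β^{(A)}_b(i_b)`: a chain component `T`, a nonempty
`A ⊆ T`, a set `b ⊆ pre(T)`, the coordinate `i_A^*` of the vector, and `i_b`. -/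
abbrev ParamIndex {G : ChainGraph V} (o : G.ConsistentOrder) (r : V → ℕ)
    [∀ v, NeZero (r v)] : Type _ :=
  Σ (T : G.Component) (A : {A : Finset V // A.Nonempty ∧ A ⊆ G.nodes T})
    (b : {b : Finset V // b ⊆ o.pre T}), StarCell r A.1 × SubCell r b.1

/-- `β` is the parameter of `p` in the saturated multivariate logistic regression model,
in the baseline coding. -/
def IsSaturatedParam {G : ChainGraph V} (o : G.ConsistentOrder) (p : Cell r → ℝ)
    (β : ParamIndex o r → ℝ) : Prop :=
  (∀ (T : G.Component) (A : {A : Finset V // A.Nonempty ∧ A ⊆ G.nodes T})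
      (iA : StarCell r A.1) (i : SubCell r (o.pre T)),
    logisticContrast p A.1 (o.pre T) iA i =
      ∑ b : {b : Finset V // b ∈ (o.pre T).powerset},
        β ⟨T, A, ⟨b.1, Finset.mem_powerset.1 b.2⟩, iA,
          fun v => i ⟨v.1, Finset.mem_powerset.1 b.2 v.2⟩⟩) ∧
  (∀ T A b iA ib, (∃ v, ib v = 0) → β ⟨T, A, b, iA, ib⟩ = 0)

/-- The parameters that the graph sets to zero. -/
def IsConstrained {G : ChainGraph V} {o : G.ConsistentOrder} (x : ParamIndex o r) : Prop :=
  (G.IsConn x.2.1.1 ∧ ¬ x.2.2.1.1 ⊆ G.parents x.2.1.1) ∨ ¬ G.IsConn x.2.1.1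

/-- The parameters that do not vanish identically by the baseline coding. -/
abbrev FreeIndex {G : ChainGraph V} (o : G.ConsistentOrder) (r : V → ℕ)
    [∀ v, NeZero (r v)] : Type _ :=
  {x : ParamIndex o r // ∀ v, x.2.2.2.2 v ≠ 0}

noncomputable instance FreeIndex.instFintype {G : ChainGraph V} (o : G.ConsistentOrder)
    (r : V → ℕ) [∀ v, NeZero (r v)] : Fintype (FreeIndex o r) := Fintype.ofFinite _

/-- The natural parameter space of the family of all strictly positive distributions:
one coordinate for every cell other than the reference cell `(0, …, 0)`. -/
abbrev NatParam {V : Type*} (r : V → ℕ) [∀ v, NeZero (r v)] : Type _ :=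
  {i : Cell r // i ≠ fun _ => 0} → ℝ

/-- The canonical statistic paired with the natural parameter: `θ_i`, and `0` at the reference. -/
noncomputable def natScore (θ : NatParam r) (i : Cell r) : ℝ :=
  if h : i ≠ fun _ => 0 then θ ⟨i, h⟩ else 0

/-- The member of the saturated (full, regular, minimal) exponential family with natural
parameter `θ`; its natural parameters are `θ_i = log (p i / p (0, …, 0))`. -/
noncomputable def expDist (θ : NatParam r) (i : Cell r) : ℝ :=
  Real.exp (natScore θ i - Real.log (∑ j, Real.exp (natScore θ j)))

/-- `S` is an embedded smooth submanifold of `E`: near each of its points, a smooth change of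
coordinates carries `S` to a fixed linear subspace. -/
def IsSmoothSubmanifold {E : Type*} [NormedAddCommGroup E] [NormedSpace ℝ E] (S : Set E) : Prop :=
  ∃ W : Submodule ℝ E, ∀ x ∈ S, ∃ φ : OpenPartialHomeomorph E E,
    x ∈ φ.source ∧ ContDiffOn ℝ ∞ φ φ.source ∧ ContDiffOn ℝ ∞ φ.symm φ.target ∧
      ∀ y ∈ φ.source, y ∈ S ↔ φ y ∈ W

/-- A curved exponential family in the saturated exponential family: its set of natural
parameters is a smooth submanifold of the natural parameter space. -/
def IsCurvedExponentialFamily (M : Set (Cell r → ℝ)) : Prop :=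
  ∃ Θ : Set (NatParam r), IsSmoothSubmanifold Θ ∧ M = expDist '' Θ

end Tables

/-! Everything rests on one vanishing principle, `eq_zero_of_contrast_eq_zero`. Let `d C` be tables
on the subsets `C` of `A`, consistent under summation, with `d ∅ = 0`, and let `l C` have no
interaction of order `C`. Then `l C` is a sum of terms that each ignore some coordinate of `C`. If
the lower `d` vanish, `d C` sums to zero over any such coordinate, so it is orthogonal to `l C`.
When `d C * l C` is positive wherever `d C ≠ 0`, this forces `d C = 0`. Monotonicity of `log`
supplies the sign when `d` is a difference of probabilities and `l` the difference of their
logarithms.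

The principle is used four times, always conditionally on `pre(T)`. Constraints imply Markov:
`condProb_eq_of_agree` compares `p(C | k)` with `p(C | k')` for two pasts that agree on the parents,
and `condProb_union_of_separated` compares `p(C)` with the product of its two separated marginals.
The converse is direct: a logarithm that ignores a coordinate, or is a sum of terms that each ignore
one, has zero contrast. Smooth parameterization: `condProb_eq_of_regParam_eq` shows that equal
parameters give equal conditionals of each component, and `tangentCond_eq_zero_of_regParam_eq_zero`
is the infinitesimal form, with a square as the positive quantity. Multiplying the conditionals
along the order of the components recovers the joint law, so the parameter map and its derivatives
are injective.

An injection of free parameters into cells makes the dimensions equal. The inverse function theorem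
then gives a diffeomorphism onto an open set, in whose coordinates the model is a linear section. -/

section Slices

/-! ### Partial sums, marginals and conditional probabilities. -/

variable {V : Type*} [Fintype V] [DecidableEq V] {r : V → ℕ}

/-- The sum of `f` over all cells that agree with `i` outside `D`. -/
noncomputable def sumOver (D : Finset V) (f : Cell r → ℝ) (i : Cell r) : ℝ :=
  ∑ j ∈ Finset.univ.filter (fun j : Cell r => ∀ v, v ∉ D → j v = i v), f j

/-- The cell with the coordinates of `k` on `B` and those of `j` elsewhere. -/
def mix (B : Finset V) (k j : Cell r) : Cell r := fun v => if v ∈ B then k v else j v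

theorem marg_eq_sumOver (p : Cell r → ℝ) (B : Finset V) (i : Cell r) :
    marg p B i = sumOver Bᶜ p i := by
  simp [marg, sumOver]

theorem sumOver_empty (f : Cell r → ℝ) (i : Cell r) : sumOver ∅ f i = f i := by
  have : (Finset.univ.filter fun j : Cell r => ∀ v, v ∉ (∅ : Finset V) → j v = i v) = {i} := by
    ext j
    simp [funext_iff]
  rw [sumOver, this, Finset.sum_singleton]

theorem sumOver_sumOver {D E : Finset V} (h : Disjoint D E) (f : Cell r → ℝ) (i : Cell r) :
    sumOver D (sumOver E f) i = sumOver (D ∪ E) f i := by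
  unfold sumOver
  -- The cells are grouped by their `D`-coordinates: `mix D k i` is the slice on which `k` lies.
  rw [← Finset.sum_fiberwise_of_maps_to
    (s := Finset.univ.filter (fun j : Cell r => ∀ v, v ∉ D ∪ E → j v = i v))
    (g := fun k => mix D k i)
    (t := Finset.univ.filter (fun j : Cell r => ∀ v, v ∉ D → j v = i v))]
  · refine Finset.sum_congr rfl fun j hj => Finset.sum_congr ?_ fun _ _ => rfl
    simp only [Finset.mem_filter, Finset.mem_univ, true_and] at hj
    ext k
    simp only [Finset.mem_filter, Finset.mem_univ, true_and, Finset.mem_union, not_or]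
    constructor
    · intro hk
      refine ⟨fun v hv => (hk v hv.2).trans (hj v hv.1), funext fun v => ?_⟩
      by_cases hv : v ∈ D
      · simp [mix, hv, hk v (Finset.disjoint_left.1 h hv)]
      · simp [mix, hv, hj v hv]
    · rintro ⟨hk, rfl⟩ v hv
      by_cases hD : v ∈ D
      · simp [mix, hD]
      · simp [mix, hD, hk v ⟨hD, hv⟩]
  · intro k _
    simp only [Finset.mem_filter, Finset.mem_univ, true_and]
    intro v hv
    simp [mix, hv]

theorem sumOver_mul_left {D : Finset V} {g : Cell r → ℝ} {S : Set V} (hg : DependsOn g S)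
    (hS : ∀ v ∈ D, v ∉ S) (f : Cell r → ℝ) (i : Cell r) :
    sumOver D (fun j => g j * f j) i = g i * sumOver D f i := by
  unfold sumOver
  rw [Finset.mul_sum]
  refine Finset.sum_congr rfl fun j hj => ?_
  simp only [Finset.mem_filter, Finset.mem_univ, true_and] at hj
  exact congrArg (· * f j) (hg fun v hv => hj v fun hD => hS v hD hv)

theorem sumOver_sum {ι : Type*} (s : Finset ι) (D : Finset V) (f : ι → Cell r → ℝ) (i : Cell r) :
    sumOver D (fun j => ∑ a ∈ s, f a j) i = ∑ a ∈ s, sumOver D (f a) i :=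
  Finset.sum_comm

theorem sumOver_sub (D : Finset V) (f g : Cell r → ℝ) (i : Cell r) :
    sumOver D (fun j => f j - g j) i = sumOver D f i - sumOver D g i :=
  Finset.sum_sub_distrib _ _

theorem sumOver_comp_mix {D B : Finset V} (h : Disjoint D B) (f : Cell r → ℝ) (k i : Cell r) :
    sumOver D (fun j => f (mix B k j)) i = sumOver D f (mix B k i) := by
  unfold sumOver
  refine Finset.sum_nbij' (fun j => mix B k j) (fun j => mix B i j) ?_ ?_ ?_ ?_ fun _ _ => rfl
  · intro j hj
    simp only [Finset.mem_filter, Finset.mem_univ, true_and] at hj ⊢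
    intro v hv
    by_cases hB : v ∈ B <;> simp [mix, hB, hj v hv]
  · intro j hj
    simp only [Finset.mem_filter, Finset.mem_univ, true_and] at hj ⊢
    intro v hv
    by_cases hB : v ∈ B
    · simp [mix, hB]
    · simpa [mix, hB] using hj v hv
  · intro j hj
    simp only [Finset.mem_filter, Finset.mem_univ, true_and] at hj
    funext v
    by_cases hB : v ∈ B
    · simp [mix, hB, hj v (Finset.disjoint_right.1 h hB)]
    · simp [mix, hB]
  · intro j hj
    simp only [Finset.mem_filter, Finset.mem_univ, true_and] at hj
    funext v
    by_cases hB : v ∈ B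
    · simpa [mix, hB] using (hj v (Finset.disjoint_right.1 h hB)).symm
    · simp [mix, hB]

theorem dependsOn_marg (p : Cell r → ℝ) (B : Finset V) : DependsOn (marg p B) (B : Set V) := by
  intro i j h
  unfold marg
  refine Finset.sum_congr (Finset.filter_congr fun k _ => forall₂_congr fun v hv => ?_)
    fun _ _ => rfl
  rw [h v hv]

theorem dependsOn_condProb (p : Cell r → ℝ) (A B : Finset V) :
    DependsOn (condProb p A B) ((A ∪ B : Finset V) : Set V) := by
  intro i j h
  unfold condProb
  rw [dependsOn_marg p _ h, dependsOn_marg p B fun v hv => h v (by simp_all)]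

theorem marg_pos {p : Cell r → ℝ} (hp : ∀ i, 0 < p i) (B : Finset V) (i : Cell r) :
    0 < marg p B i :=
  Finset.sum_pos (fun j _ => hp j) ⟨i, by simp⟩

theorem condProb_pos {p : Cell r → ℝ} (hp : ∀ i, 0 < p i) (A B : Finset V) (i : Cell r) :
    0 < condProb p A B i :=
  div_pos (marg_pos hp _ _) (marg_pos hp _ _)

theorem condProb_empty {p : Cell r → ℝ} (hp : ∀ i, 0 < p i) (B : Finset V) (i : Cell r) :
    condProb p ∅ B i = 1 := by
  rw [condProb, Finset.empty_union, div_self (marg_pos hp _ _).ne']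

theorem marg_univ (p : Cell r → ℝ) (i : Cell r) : marg p Finset.univ i = p i := by
  rw [marg_eq_sumOver, Finset.compl_univ, sumOver_empty]

theorem sumOver_marg (p : Cell r → ℝ) {C D : Finset V} (h : D ⊆ C) (i : Cell r) :
    sumOver D (marg p C) i = marg p (C \ D) i := by
  have : marg p C = sumOver Cᶜ p := funext (marg_eq_sumOver p C)
  rw [this, sumOver_sumOver (disjoint_compl_right.mono_left h), marg_eq_sumOver]
  congr 1
  ext v
  simp only [Finset.mem_union, Finset.mem_compl, Finset.mem_sdiff, not_and, not_not]
  tauto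

theorem sumOver_condProb (p : Cell r → ℝ) {A B D : Finset V} (hAB : Disjoint A B) (h : D ⊆ A)
    (i : Cell r) : sumOver D (condProb p A B) i = condProb p (A \ D) B i := by
  have hc : condProb p A B = fun j => (marg p B j)⁻¹ * marg p (A ∪ B) j := by
    funext j
    rw [condProb, div_eq_inv_mul]
  have hg : DependsOn (fun j => (marg p B j)⁻¹) (B : Set V) := fun i j hij =>
    congrArg (·⁻¹) (dependsOn_marg p B hij)
  have hDB : Disjoint D B := hAB.mono_left h
  rw [hc, sumOver_mul_left hg fun v hv hvB => Finset.disjoint_left.1 hDB hv (by simpa using hvB),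
    sumOver_marg p (h.trans Finset.subset_union_left), condProb, div_eq_inv_mul,
    Finset.union_sdiff_distrib, Finset.sdiff_eq_self_of_disjoint hDB.symm]

end Slices

/-! ### Baseline contrasts and Möbius inversion. -/

section Contrasts

variable {V : Type*} [DecidableEq V] {r : V → ℕ} [∀ v, NeZero (r v)]

/-- The cell `i` with the coordinates in `D` set to the first level. -/
def resetOn (D : Finset V) (i : Cell r) : Cell r := fun v => if v ∈ D then 0 else i v

/-- The baseline contrast of `f` in the coordinates `A`. -/
noncomputable def contrast (A : Finset V) (f : Cell r → ℝ) (i : Cell r) : ℝ :=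
  ∑ D ∈ A.powerset, (-1 : ℝ) ^ D.card * f (resetOn D i)

theorem resetOn_empty (i : Cell r) : resetOn ∅ i = i := by
  funext v
  simp [resetOn]

theorem resetOn_resetOn (D E : Finset V) (i : Cell r) :
    resetOn D (resetOn E i) = resetOn (D ∪ E) i := by
  funext v
  by_cases hD : v ∈ D <;> by_cases hE : v ∈ E <;> simp [resetOn, hD, hE]

theorem contrast_congr {A : Finset V} {f g : Cell r → ℝ} {i j : Cell r}
    (h : ∀ D ⊆ A, f (resetOn D i) = g (resetOn D j)) : contrast A f i = contrast A g j :=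
  Finset.sum_congr rfl fun D hD => by rw [h D (Finset.mem_powerset.1 hD)]

/-- The terms of `D` and `insert v D` carry opposite signs and cancel in pairs. -/
theorem contrast_eq_zero_of_insert {A : Finset V} {f : Cell r → ℝ} {i : Cell r} {v : V}
    (hv : v ∈ A) (h : ∀ D ⊆ A.erase v, f (resetOn (insert v D) i) = f (resetOn D i)) :
    contrast A f i = 0 := by
  unfold contrast
  rw [← Finset.insert_erase hv, Finset.sum_powerset_insert (Finset.notMem_erase v A),
    ← Finset.sum_add_distrib]
  refine Finset.sum_eq_zero fun D hD => ?_
  rw [Finset.mem_powerset] at hD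
  rw [h D hD, Finset.card_insert_of_notMem fun hvD => Finset.notMem_erase v A (hD hvD)]
  ring

theorem contrast_eq_zero_of_dependsOn {A : Finset V} {f : Cell r → ℝ} {S : Set V}
    (hf : DependsOn f S) {v : V} (hv : v ∈ A) (hvS : v ∉ S) (i : Cell r) :
    contrast A f i = 0 := by
  refine contrast_eq_zero_of_insert hv fun D _ => hf fun w hw => ?_
  have : w ≠ v := fun h => hvS (h ▸ hw)
  simp [resetOn, this]

theorem contrast_eq_zero_of_coord {A : Finset V} (f : Cell r → ℝ) {i : Cell r} {v : V}
    (hv : v ∈ A) (hi : i v = 0) : contrast A f i = 0 := by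
  refine contrast_eq_zero_of_insert hv fun D _ => congrArg f (funext fun w => ?_)
  by_cases h : w = v
  · subst h
    simp [resetOn, hi]
  · simp [resetOn, h]

theorem contrast_sum {ι : Type*} (s : Finset ι) (A : Finset V) (f : ι → Cell r → ℝ) (i : Cell r) :
    contrast A (fun j => ∑ a ∈ s, f a j) i = ∑ a ∈ s, contrast A (f a) i := by
  unfold contrast
  rw [Finset.sum_comm]
  simp_rw [Finset.mul_sum]

theorem contrast_sub (A : Finset V) (f g : Cell r → ℝ) (i : Cell r) :
    contrast A (fun j => f j - g j) i = contrast A f i - contrast A g i := by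
  simp only [contrast, mul_sub, Finset.sum_sub_distrib]

theorem contrast_comp_mix {A B : Finset V} (h : Disjoint A B) (f : Cell r → ℝ) (k i : Cell r) :
    contrast A (fun j => f (mix B k j)) i = contrast A f (mix B k i) := by
  refine contrast_congr fun D hD => congrArg f (funext fun v => ?_)
  by_cases hB : v ∈ B
  · have : v ∉ D := fun hvD => Finset.disjoint_left.1 h (hD hvD) hB
    simp [resetOn, mix, hB, this]
  · simp [resetOn, mix, hB]

/-- Möbius inversion by peeling off `a`: the terms with `a ∉ b` cancel those with `a ∈ D`, and what
remains, `a ∈ b` and `a ∉ D`, is the sum for `A`. -/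
theorem sum_powerset_alternating (A : Finset V) (H : Finset V → ℝ) :
    ∑ b ∈ A.powerset, ∑ D ∈ b.powerset, (-1 : ℝ) ^ D.card * H ((A \ b) ∪ D) = H ∅ := by
  induction A using Finset.induction_on generalizing H with
  | empty => simp
  | insert a A ha ih =>
    rw [Finset.sum_powerset_insert ha, ← Finset.sum_add_distrib, ← ih H]
    refine Finset.sum_congr rfl fun b hb => ?_
    rw [Finset.mem_powerset] at hb
    have hab : a ∉ b := fun h => ha (hb h)
    rw [Finset.sum_powerset_insert hab, ← Finset.sum_add_distrib, ← Finset.sum_add_distrib]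
    refine Finset.sum_congr rfl fun D hD => ?_
    rw [Finset.mem_powerset] at hD
    have haD : a ∉ D := fun h => hab (hD h)
    have h₁ : insert a A \ b ∪ D = insert a (A \ b ∪ D) := by
      rw [Finset.insert_sdiff_of_notMem _ hab, Finset.insert_union]
    have h₂ : insert a A \ insert a b = A \ b := by
      rw [Finset.insert_sdiff_insert, Finset.sdiff_insert, Finset.erase_eq_of_notMem]
      simp [ha]
    rw [h₁, h₂, Finset.union_insert, Finset.card_insert_of_notMem haD]
    ring

theorem sum_contrast (A : Finset V) (f : Cell r → ℝ) (i : Cell r) :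
    ∑ b ∈ A.powerset, contrast b (fun j => f (resetOn (A \ b) j)) i = f i := by
  have := sum_powerset_alternating A fun D => f (resetOn D i)
  simpa only [contrast, resetOn_resetOn, resetOn_empty] using this

end Contrasts

/-! ### The vanishing principle. -/

section Vanishing

variable {V : Type*} [Fintype V] [DecidableEq V] {r : V → ℕ} [∀ v, NeZero (r v)]

/-- A consistent family of marginal tables `d` vanishes if it is paired positively with a family
`l` of tables that have no interaction of the highest order. -/
theorem eq_zero_of_contrast_eq_zero {A : Finset V} {d l : Finset V → Cell r → ℝ}
    (hsum : ∀ C ⊆ A, ∀ D ⊆ C, ∀ i, sumOver D (d C) i = d (C \ D) i)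
    (hempty : ∀ i, d ∅ i = 0)
    (hcontrast : ∀ C ⊆ A, C.Nonempty → ∀ i : Cell r, (∀ v ∈ C, i v ≠ 0) → contrast C (l C) i = 0)
    (hpos : ∀ C ⊆ A, ∀ i, d C i ≠ 0 → 0 < d C i * l C i) :
    ∀ C ⊆ A, ∀ i, d C i = 0 := by
  intro C
  induction C using Finset.strongInduction with
  | H C ih =>
    intro hC i
    rcases C.eq_empty_or_nonempty with rfl | hne
    · exact hempty i
    have hl : ∀ j, l C j = ∑ b ∈ C.powerset, contrast b (fun k => l C (resetOn (C \ b) k)) j :=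
      fun j => (sum_contrast C (l C) j).symm
    have hzero : sumOver C (fun j => d C j * l C j) i = 0 := by
      have hfun : (fun j => d C j * l C j) = fun j => ∑ b ∈ C.powerset,
          d C j * contrast b (fun k => l C (resetOn (C \ b) k)) j :=
        funext fun j => by rw [← Finset.mul_sum, ← hl]
      rw [hfun, sumOver_sum]
      refine Finset.sum_eq_zero fun b hb => ?_
      rw [Finset.mem_powerset] at hb
      rcases hb.eq_or_ssubset with rfl | hbC
      · refine Finset.sum_eq_zero fun j _ => mul_eq_zero_of_right _ ?_
        by_cases hj : ∀ v ∈ b, j v ≠ 0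
        · simpa only [Finset.sdiff_self, resetOn_empty] using hcontrast b hC hne j hj
        · push Not at hj
          obtain ⟨v, hv, hjv⟩ := hj
          exact contrast_eq_zero_of_coord _ hv hjv
      -- A lower interaction ignores the coordinates in `C \ b`. Summing these out first turns `d C`
      -- into `d b`, which is zero by induction.
      · have hdep : DependsOn (contrast b fun k => l C (resetOn (C \ b) k))
            ((C \ b : Finset V) : Set V)ᶜ := by
          intro x y hxy
          refine contrast_congr fun D _ => congrArg _ (funext fun v => ?_)
          by_cases hv : v ∈ C \ b
          · simp only [resetOn, hv, if_true]
          · have := hxy v (by simpa using hv)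
            simp only [resetOn, this]
        have hinner : ∀ j, sumOver (C \ b)
            (fun j => d C j * contrast b (fun k => l C (resetOn (C \ b) k)) j) j = 0 := by
          intro j
          simp_rw [mul_comm (d C _)]
          rw [sumOver_mul_left hdep (fun v hv => by simpa using hv),
            hsum C hC _ Finset.sdiff_subset, Finset.sdiff_sdiff_eq_self hb,
            ih b hbC (hb.trans hC), mul_zero]
        have hsplit : ∀ f : Cell r → ℝ, sumOver C f i = sumOver b (sumOver (C \ b) f) i :=
          fun f => by
            rw [sumOver_sumOver Finset.disjoint_sdiff, Finset.union_sdiff_of_subset hb]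
        rw [hsplit]
        exact Finset.sum_eq_zero fun j _ => hinner j
    by_contra hi
    -- All terms of the pairing are nonnegative and the one at `i` is positive, yet the sum is zero.
    refine (Finset.sum_pos' (fun j _ => ?_) ⟨i, by simp, hpos C hC i hi⟩).ne' hzero
    by_cases hj : d C j = 0
    · simp [hj]
    · exact (hpos C hC j hj).le

theorem sub_mul_log_sub_log_pos {a b : ℝ} (ha : 0 < a) (hb : 0 < b) (h : a - b ≠ 0) :
    0 < (a - b) * (Real.log a - Real.log b) := by
  rcases lt_or_gt_of_ne (sub_ne_zero.1 h) with hab | hab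
  · exact mul_pos_of_neg_of_neg (sub_neg.2 hab) (sub_neg.2 (Real.log_lt_log ha hab))
  · exact mul_pos (sub_pos.2 hab) (sub_pos.2 (Real.log_lt_log hb hab))

end Vanishing

/-! ### The baseline expansion and its uniqueness. -/

section Expansion

variable {V : Type*} [DecidableEq V] {r : V → ℕ} [∀ v, NeZero (r v)]

/-- The extension of a marginal cell by the first level. -/
def extendCell {b : Finset V} (ib : SubCell r b) : Cell r :=
  fun v => if h : v ∈ b then ib ⟨v, h⟩ else 0

theorem extendCell_of_mem {b : Finset V} (ib : SubCell r b) {v : V} (h : v ∈ b) :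
    extendCell ib v = ib ⟨v, h⟩ := dif_pos h

theorem extendCell_of_notMem {b : Finset V} (ib : SubCell r b) {v : V} (h : v ∉ b) :
    extendCell ib v = 0 := dif_neg h

/-- The coefficient of `b` in the baseline expansion of a function on a marginal table. -/
noncomputable def baselineCoeff {B : Finset V} (N : SubCell r B → ℝ) (b : Finset V)
    (ib : SubCell r b) : ℝ :=
  contrast b (fun j => N fun v => j v) (extendCell ib)

theorem baselineCoeff_eq_zero {B : Finset V} (N : SubCell r B → ℝ) {b : Finset V}
    {ib : SubCell r b} {v : {v // v ∈ b}} (h : ib v = 0) : baselineCoeff N b ib = 0 :=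
  contrast_eq_zero_of_coord _ v.2 ((extendCell_of_mem ib v.2).trans h)

theorem sum_baselineCoeff {B : Finset V} (N : SubCell r B → ℝ) (i : SubCell r B) :
    N i = ∑ b : {b : Finset V // b ∈ B.powerset},
      baselineCoeff N b.1 fun v => i ⟨v.1, Finset.mem_powerset.1 b.2 v.2⟩ := by
  have h := sum_contrast B (fun j => N fun v => j v) (extendCell i)
  have hi : (fun v : {v // v ∈ B} => extendCell i v) = i := funext fun v => extendCell_of_mem i v.2
  rw [hi] at h
  rw [← h, ← Finset.sum_coe_sort]
  refine Finset.sum_congr rfl fun b _ => contrast_congr fun D hD => congrArg N (funext fun v => ?_)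
  by_cases hb : (v : V) ∈ b.1
  · by_cases hvD : (v : V) ∈ D <;> simp [resetOn, hb, hvD, extendCell]
  · by_cases hvD : (v : V) ∈ D <;> simp [resetOn, hb, hvD, extendCell]

/-- Take the contrast over `b` of the whole expansion. A term `b'` not containing `b` ignores a
coordinate of `b`; a term `b'` strictly larger than `b` is evaluated at a cell with a baseline
coordinate. Only `b' = b` with `D = ∅` survives. -/
theorem baselineCoeff_eq {B : Finset V} {N : SubCell r B → ℝ}
    {γ : ∀ b : {b : Finset V // b ⊆ B}, SubCell r b.1 → ℝ}
    (hγ : ∀ b ib, (∃ v, ib v = 0) → γ b ib = 0)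
    (hN : ∀ i, N i = ∑ b : {b : Finset V // b ∈ B.powerset},
      γ ⟨b.1, Finset.mem_powerset.1 b.2⟩ fun v => i ⟨v.1, Finset.mem_powerset.1 b.2 v.2⟩)
    (b : {b : Finset V // b ⊆ B}) (ib : SubCell r b.1) :
    γ b ib = baselineCoeff N b.1 ib := by
  unfold baselineCoeff
  simp_rw [hN]
  rw [contrast_sum, Finset.sum_eq_single ⟨b.1, Finset.mem_powerset.2 b.2⟩]
  · unfold contrast
    rw [Finset.sum_eq_single ∅]
    · have : (fun v : {v // v ∈ b.1} => extendCell ib v) = ib :=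
        funext fun v => extendCell_of_mem ib v.2
      simp [resetOn_empty, this]
    · intro D hD hne
      obtain ⟨v, hv⟩ := Finset.nonempty_iff_ne_empty.2 hne
      refine mul_eq_zero_of_right _ (hγ _ _ ⟨⟨v, Finset.mem_powerset.1 hD hv⟩, ?_⟩)
      simp [resetOn, hv]
    · simp
  · intro b' _ hne
    by_cases hsub : b.1 ⊆ b'.1
    · have : ¬ b'.1 ⊆ b.1 := fun h => hne (Subtype.ext (h.antisymm hsub))
      obtain ⟨v, hv', hv⟩ := Finset.not_subset.1 this
      refine Finset.sum_eq_zero fun D _ => mul_eq_zero_of_right _ (hγ _ _ ⟨⟨v, hv'⟩, ?_⟩)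
      simp [resetOn, extendCell_of_notMem ib hv]
    · obtain ⟨v, hv, hv'⟩ := Finset.not_subset.1 hsub
      refine contrast_eq_zero_of_dependsOn (S := (b'.1 : Set V)) ?_ hv (by simpa using hv') _
      intro x y hxy
      exact congrArg _ (funext fun w => hxy w.1 (by simp))
  · simp

/-- The contrast that defines the multivariate logistic parameters, of a function `f` on the
table `A ∪ B`. -/
noncomputable def glueContrast (f : Cell r → ℝ) (A B : Finset V) (iA : StarCell r A)
    (iB : SubCell r B) : ℝ :=
  ∑ s ∈ A.powerset, (-1 : ℝ) ^ (A \ s).card * f (glue s iA iB)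

theorem glueContrast_eq_contrast {f : Cell r → ℝ} {A B : Finset V}
    (hf : DependsOn f ((A ∪ B : Finset V) : Set V)) {iA : StarCell r A}
    {iB : SubCell r B} {j : Cell r} (hA : ∀ v : {v // v ∈ A}, j v = iA v)
    (hB : ∀ v : {v // v ∈ B}, j v = iB v) :
    glueContrast f A B iA iB = contrast A f j := by
  unfold glueContrast contrast
  -- Keeping the levels on `s` is the same as resetting those on `A \ s`.
  refine Finset.sum_nbij' (fun s => A \ s) (fun s => A \ s) ?_ ?_ ?_ ?_ ?_
  · intro s _
    simp
  · intro s _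
    simp
  · intro s hs
    exact Finset.sdiff_sdiff_eq_self (Finset.mem_powerset.1 hs)
  · intro s hs
    exact Finset.sdiff_sdiff_eq_self (Finset.mem_powerset.1 hs)
  · intro s hs
    congr 1
    refine hf fun v hv => ?_
    by_cases hvA : v ∈ A
    · by_cases hvs : v ∈ s <;> simp [glue, resetOn, hvA, hvs, hA ⟨v, hvA⟩]
    · have hvB : v ∈ B := by simpa [hvA] using hv
      simp [glue, resetOn, hvA, hvB, hB ⟨v, hvB⟩]

theorem glueContrast_eq_contrast_glue {f : Cell r → ℝ} {A B : Finset V}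
    (hf : DependsOn f ((A ∪ B : Finset V) : Set V)) (hAB : Disjoint A B) (iA : StarCell r A)
    (iB : SubCell r B) : glueContrast f A B iA iB = contrast A f (glue A iA iB) := by
  refine glueContrast_eq_contrast hf (fun v => ?_) (fun v => ?_)
  · simp [glue, v.2]
  · simp [glue, v.2, Finset.disjoint_right.1 hAB v.2]

theorem glueContrast_sub (f g : Cell r → ℝ) (A B : Finset V) (iA : StarCell r A)
    (iB : SubCell r B) : glueContrast (fun j => f j - g j) A B iA iB =
      glueContrast f A B iA iB - glueContrast g A B iA iB := by
  simp only [glueContrast, mul_sub, Finset.sum_sub_distrib]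

end Expansion

/-! ### Regression coefficients as a linear operation on a family of tables. -/

section Parameters

variable {V : Type*} [Fintype V] [DecidableEq V] {r : V → ℕ} [∀ v, NeZero (r v)]
  {G : ChainGraph V} (o : G.ConsistentOrder)

/-- The regression coefficients of the contrasts of a family `F` of functions on the tables
`A ∪ pre(T)`. -/
noncomputable def regParam (F : Finset V → Finset V → Cell r → ℝ) (x : ParamIndex o r) : ℝ :=
  baselineCoeff (glueContrast (F x.2.1.1 (o.pre x.1)) x.2.1.1 (o.pre x.1) x.2.2.2.1)
    x.2.2.1.1 x.2.2.2.2

/-- The logarithms of the conditional probabilities. -/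
noncomputable def logCond (p : Cell r → ℝ) (A B : Finset V) (i : Cell r) : ℝ :=
  Real.log (condProb p A B i)

theorem isSaturatedParam_iff (p : Cell r → ℝ) (β : ParamIndex o r → ℝ) :
    IsSaturatedParam o p β ↔ β = regParam o (logCond p) := by
  constructor
  · rintro ⟨h₁, h₂⟩
    funext ⟨T, A, b, iA, ib⟩
    exact baselineCoeff_eq (γ := fun b ib => β ⟨T, A, b, iA, ib⟩)
      (fun b ib => h₂ T A b iA ib) (h₁ T A iA) b ib
  · rintro rfl
    exact ⟨fun T A iA i => sum_baselineCoeff _ i,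
      fun T A b iA ib ⟨v, hv⟩ => baselineCoeff_eq_zero _ hv⟩

theorem regParam_sub (F F' : Finset V → Finset V → Cell r → ℝ) (x : ParamIndex o r) :
    regParam o (fun A B i => F A B i - F' A B i) x = regParam o F x - regParam o F' x := by
  unfold regParam baselineCoeff
  rw [← contrast_sub]
  simp only [glueContrast_sub]

theorem regParam_eq_zero_of_coord (F : Finset V → Finset V → Cell r → ℝ) (x : ParamIndex o r)
    (hx : ¬ ∀ v, x.2.2.2.2 v ≠ 0) : regParam o F x = 0 := by
  push Not at hx
  obtain ⟨v, hv⟩ := hx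
  exact baselineCoeff_eq_zero _ hv

theorem contrast_eq_zero_of_regParam_eq_zero {F : Finset V → Finset V → Cell r → ℝ}
    {T : G.Component} {A : {A : Finset V // A.Nonempty ∧ A ⊆ G.nodes T}}
    (hF : DependsOn (F A.1 (o.pre T)) ((A.1 ∪ o.pre T : Finset V) : Set V))
    (h : ∀ b iA ib, regParam o F ⟨T, A, b, iA, ib⟩ = 0) {i : Cell r}
    (hi : ∀ v ∈ A.1, i v ≠ 0) : contrast A.1 (F A.1 (o.pre T)) i = 0 := by
  rw [← glueContrast_eq_contrast hF (iA := fun v => ⟨i v, hi v v.2⟩) (iB := fun v => i v)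
    (fun _ => rfl) (fun _ => rfl), sum_baselineCoeff (glueContrast _ _ _ _)]
  exact Finset.sum_eq_zero fun b _ => h ⟨b.1, Finset.mem_powerset.1 b.2⟩ _ _

end Parameters

/-! ### Combinatorics of chain graphs: connected pieces, parents, the past. -/

namespace ChainGraph

variable {V : Type*} {G : ChainGraph V}

/-- A path inside `C` that starts in `A₁` can never leave `A₁`. -/
theorem not_isConn_of_separated [DecidableEq V] {A₁ A₂ C : Finset V} (hd : Disjoint A₁ A₂)
    (hsep : ∀ v ∈ A₁, ∀ w ∈ A₂, ¬ G.undir.Adj v w) (hC : C ⊆ A₁ ∪ A₂) {v w : V} (hvC : v ∈ C)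
    (hv : v ∈ A₁) (hwC : w ∈ C) (hw : w ∈ A₂) : ¬ G.IsConn C := by
  intro h
  have hr := h ⟨v, hvC⟩ ⟨w, hwC⟩
  rw [SimpleGraph.reachable_iff_reflTransGen] at hr
  have key : ∀ y, Relation.ReflTransGen (G.undir.induce (C : Set V)).Adj ⟨v, hvC⟩ y →
      (y : V) ∈ A₁ := by
    intro y hy
    induction hy with
    | refl => exact hv
    | @tail a b _ hab ih =>
      rcases Finset.mem_union.1 (hC b.2) with hb | hb
      · exact hb
      · exact absurd hab (hsep _ ih _ hb)
  exact Finset.disjoint_left.1 hd (key _ hr) hw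

theorem JoinedIn.symm {A : Finset V} {v w : V} (h : G.JoinedIn A v w) : G.JoinedIn A w v := by
  obtain ⟨hv, hw, h⟩ := h
  exact ⟨hw, hv, h.symm⟩

theorem JoinedIn.trans {A : Finset V} {u v w : V} (h : G.JoinedIn A u v)
    (h' : G.JoinedIn A v w) : G.JoinedIn A u w := by
  obtain ⟨hu, _, h⟩ := h
  obtain ⟨_, hw, h'⟩ := h'
  exact ⟨hu, hw, h.trans h'⟩

theorem JoinedIn.refl {A : Finset V} {v : V} (h : v ∈ A) : G.JoinedIn A v v :=
  ⟨h, h, SimpleGraph.Reachable.refl _⟩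

theorem JoinedIn.of_adj {A : Finset V} {v w : V} (hv : v ∈ A) (hw : w ∈ A)
    (h : G.undir.Adj v w) : G.JoinedIn A v w :=
  ⟨hv, hw, SimpleGraph.Adj.reachable (G := G.undir.induce (A : Set V)) (u := ⟨v, hv⟩)
    (v := ⟨w, hw⟩) h⟩

theorem mem_pieces [DecidableEq V] {A K : Finset V} :
    K ∈ G.pieces A ↔ ∃ v ∈ A, ∀ w, w ∈ K ↔ G.JoinedIn A v w := by
  classical
  simp only [pieces, Finset.mem_image]
  refine exists_congr fun v => and_congr_right fun _ => ?_
  constructor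
  · rintro rfl w
    rw [Finset.mem_filter]
    exact ⟨fun h => h.2, fun h => ⟨h.2.1, h⟩⟩
  · intro h
    ext w
    rw [Finset.mem_filter, h w]
    exact ⟨fun h => h.2, fun h => ⟨h.2.1, h⟩⟩

/-- An undirected path from `v` back to `w` would close a semi-directed cycle. -/
theorem connectedComponentMk_ne_of_dir {v w : V} (h : G.dir w v) :
    G.undir.connectedComponentMk w ≠ G.undir.connectedComponentMk v := by
  intro he
  refine G.no_semidirected_cycle w v h ?_
  have hr := (SimpleGraph.ConnectedComponent.exact he).symm
  rw [SimpleGraph.reachable_iff_reflTransGen] at hr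
  exact Relation.ReflTransGen.mono (fun _ _ hab => Or.inl hab) _ _ hr

theorem subset_of_mem_pieces [DecidableEq V] {A K : Finset V} (hK : K ∈ G.pieces A) : K ⊆ A := by
  obtain ⟨v, _, h⟩ := mem_pieces.1 hK
  exact fun w hw => ((h w).1 hw).2.1

theorem biUnion_pieces [DecidableEq V] (A : Finset V) : (G.pieces A).biUnion id = A := by
  classical
  ext v
  simp only [Finset.mem_biUnion, id]
  constructor
  · rintro ⟨K, hK, hv⟩
    exact subset_of_mem_pieces hK hv
  · intro hv
    refine ⟨A.filter fun w => G.JoinedIn A v w, mem_pieces.2 ⟨v, hv, fun w => ?_⟩, ?_⟩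
    · rw [Finset.mem_filter]
      exact ⟨fun h => h.2, fun h => ⟨h.2.1, h⟩⟩
    · rw [Finset.mem_filter]
      exact ⟨hv, JoinedIn.refl hv⟩

theorem eq_of_joinedIn_of_mem_pieces [DecidableEq V] {A K K' : Finset V} (hK : K ∈ G.pieces A)
    (hK' : K' ∈ G.pieces A) {v w : V} (hv : v ∈ K) (hw : w ∈ K') (h : G.JoinedIn A v w) :
    K = K' := by
  obtain ⟨a, _, ha⟩ := mem_pieces.1 hK
  obtain ⟨a', _, ha'⟩ := mem_pieces.1 hK'
  have haa' : G.JoinedIn A a a' := (((ha v).1 hv).trans h).trans ((ha' w).1 hw).symm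
  ext u
  rw [ha, ha']
  exact ⟨fun hu => haa'.symm.trans hu, fun hu => haa'.trans hu⟩

theorem exists_mem_notMem_of_mem_pieces [DecidableEq V] {A K : Finset V} (hA : ¬ G.IsConn A)
    (hK : K ∈ G.pieces A) : ∃ v ∈ A, v ∉ K := by
  by_contra hall
  push Not at hall
  obtain ⟨a, _, ha⟩ := mem_pieces.1 hK
  refine hA fun x y => ?_
  obtain ⟨_, _, h⟩ := ((ha _).1 (hall x x.2)).symm.trans ((ha _).1 (hall y y.2))
  exact h

variable [Fintype V]

theorem mem_nodes {T : G.Component} {v : V} :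
    v ∈ G.nodes T ↔ G.undir.connectedComponentMk v = T := by
  simp [nodes]

theorem ConsistentOrder.mem_pre {o : G.ConsistentOrder} {T : G.Component} {v : V} :
    v ∈ o.pre T ↔ o.prec T (G.undir.connectedComponentMk v) := by
  simp [pre]

theorem ConsistentOrder.disjoint_nodes_pre (o : G.ConsistentOrder) (T : G.Component) :
    Disjoint (G.nodes T) (o.pre T) :=
  Finset.disjoint_left.2 fun _ hv hv' =>
    o.irrefl T (by simpa only [mem_nodes.1 hv] using ConsistentOrder.mem_pre.1 hv')

theorem mem_parents [DecidableEq V] {A : Finset V} {w : V} :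
    w ∈ G.parents A ↔ w ∉ A ∧ ∃ v ∈ A, G.dir w v := by
  simp [parents]

theorem parents_subset_pre [DecidableEq V] (o : G.ConsistentOrder) {T : G.Component} {A : Finset V}
    (hA : A ⊆ G.nodes T) : G.parents A ⊆ o.pre T := by
  intro w hw
  obtain ⟨-, v, hv, hwv⟩ := mem_parents.1 hw
  have hvT := mem_nodes.1 (hA hv)
  have hne := hvT ▸ connectedComponentMk_ne_of_dir hwv
  rw [ConsistentOrder.mem_pre]
  exact (o.total _ _ hne).resolve_left fun h => o.consistent _ _ h ⟨w, v, rfl, hvT, hwv⟩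

theorem parents_subset_parents [DecidableEq V] {T : G.Component} {A C : Finset V} (hA : A ⊆ G.nodes T)
    (hC : C ⊆ A) : G.parents C ⊆ G.parents A := by
  intro w hw
  obtain ⟨-, v, hv, hwv⟩ := mem_parents.1 hw
  refine mem_parents.2 ⟨fun hwA => connectedComponentMk_ne_of_dir hwv ?_, v, hC hv, hwv⟩
  rw [mem_nodes.1 (hA hwA), mem_nodes.1 (hA (hC hv))]

/-- Induction along a consistent order: a property of node sets passes from the empty set to the
set of all nodes if it passes from `pre(T)` to `T ∪ pre(T)` for each component `T`. -/
theorem ConsistentOrder.induction_univ [DecidableEq V] (o : G.ConsistentOrder)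
    {P : Finset V → Prop} (hempty : P ∅)
    (hstep : ∀ T, P (o.pre T) → P (G.nodes T ∪ o.pre T)) : P Finset.univ := by
  have key : ∀ S : Finset V, (∀ v ∈ S, ∀ w, G.undir.connectedComponentMk v =
      G.undir.connectedComponentMk w ∨ o.prec (G.undir.connectedComponentMk v)
        (G.undir.connectedComponentMk w) → w ∈ S) → P S := by
    intro S
    induction S using Finset.strongInduction with
    | H S ih =>
      intro hS
      rcases S.eq_empty_or_nonempty with rfl | ⟨v₀, hv₀⟩
      · exact hempty
      have : IsTrans G.Component o.prec := ⟨o.trans⟩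
      have : Std.Irrefl o.prec := ⟨o.irrefl⟩
      have hwf : WellFounded o.prec := Finite.wellFounded_of_trans_of_irrefl o.prec
      -- `S` is closed under passing to the past, so it consists of its `≺`-least component together
      -- with all of that component's past.
      obtain ⟨T, ⟨v, hv, hvT⟩, hmin⟩ :=
        hwf.has_min {T | ∃ v ∈ S, G.undir.connectedComponentMk v = T} ⟨_, v₀, hv₀, rfl⟩
      have hST : S = G.nodes T ∪ o.pre T := by
        ext w
        rw [Finset.mem_union, mem_nodes, mem_pre]
        constructor
        · intro hw
          by_cases hwT : G.undir.connectedComponentMk w = T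
          · exact Or.inl hwT
          · exact Or.inr ((o.total _ _ hwT).resolve_left (hmin _ ⟨w, hw, rfl⟩))
        · intro hw
          refine hS v hv w ?_
          rw [hvT]
          exact hw.imp Eq.symm id
      rw [hST]
      refine hstep T (ih _ ?_ ?_)
      · rw [hST]
        refine (Finset.ssubset_iff_of_subset Finset.subset_union_right).2 ⟨v, ?_, ?_⟩
        · exact Finset.mem_union_left _ (mem_nodes.2 hvT)
        · exact Finset.disjoint_left.1 (o.disjoint_nodes_pre T) (mem_nodes.2 hvT)
      · intro a ha b hab
        rw [mem_pre] at ha ⊢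
        rcases hab with hab | hab
        · exact hab ▸ ha
        · exact o.trans _ _ _ ha hab
  exact key _ fun _ _ _ _ => Finset.mem_univ _

end ChainGraph

/-! ### The Markov property is equivalent to the zero constraints. -/

section Markov

open ChainGraph

variable {V : Type*} [Fintype V] [DecidableEq V] {r : V → ℕ}

theorem sumOver_condProb_mul (p : Cell r → ℝ) {A₁ A₂ B D₁ D₂ : Finset V} (h₁₂ : Disjoint A₁ A₂)
    (h₁ : Disjoint A₁ B) (h₂ : Disjoint A₂ B) (hD₁ : D₁ ⊆ A₁) (hD₂ : D₂ ⊆ A₂) (i : Cell r) :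
    sumOver (D₁ ∪ D₂) (fun j => condProb p A₁ B j * condProb p A₂ B j) i =
      condProb p (A₁ \ D₁) B i * condProb p (A₂ \ D₂) B i := by
  rw [← sumOver_sumOver (h₁₂.mono hD₁ hD₂)]
  have hinner : sumOver D₂ (fun j => condProb p A₁ B j * condProb p A₂ B j) =
      fun j => condProb p (A₂ \ D₂) B j * condProb p A₁ B j := by
    funext j
    rw [sumOver_mul_left (dependsOn_condProb p A₁ B), sumOver_condProb p h₂ hD₂, mul_comm]
    intro v hv
    simp [Finset.disjoint_right.1 h₁₂ (hD₂ hv), Finset.disjoint_left.1 h₂ (hD₂ hv)]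
  rw [hinner, sumOver_mul_left (dependsOn_condProb p _ B), sumOver_condProb p h₁ hD₁, mul_comm]
  intro v hv
  simp [Finset.disjoint_left.1 h₁₂ (hD₁ hv), Finset.disjoint_left.1 h₁ (hD₁ hv)]

theorem dependsOn_logCond (p : Cell r → ℝ) (A B : Finset V) :
    DependsOn (logCond p A B) ((A ∪ B : Finset V) : Set V) :=
  fun _ _ h => congrArg Real.log (dependsOn_condProb p A B h)

variable {G : ChainGraph V} {o : G.ConsistentOrder} {p : Cell r → ℝ}

/-- Turns the independence into a statement about which coordinates the conditional ignores, the
form in which contrasts can detect it. -/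
theorem condIndep_parents_iff (hp : ∀ i, 0 < p i) {T : G.Component} {A : Finset V}
    (hA : A ⊆ G.nodes T) :
    CondIndep p A (o.pre T \ G.parents A) (G.parents A) ↔
      DependsOn (condProb p A (o.pre T)) ((A ∪ G.parents A : Finset V) : Set V) := by
  have hpa := parents_subset_pre o hA
  have hAB : Disjoint A (o.pre T) := (o.disjoint_nodes_pre T).mono_left hA
  unfold CondIndep
  rw [Finset.union_assoc, Finset.sdiff_union_of_subset hpa]
  constructor
  · intro h
    have hc : condProb p A (o.pre T) = condProb p A (G.parents A) := by
      funext i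
      rw [condProb, condProb, div_eq_div_iff (marg_pos hp _ _).ne' (marg_pos hp _ _).ne', h i]
    rw [hc]
    exact dependsOn_condProb p _ _
  · intro h i
    have hmul : marg p (A ∪ o.pre T) =
        fun j => condProb p A (o.pre T) j * marg p (o.pre T) j := by
      funext j
      rw [condProb, div_mul_cancel₀ _ (marg_pos hp _ _).ne']
    have hsub : o.pre T \ G.parents A ⊆ o.pre T := Finset.sdiff_subset
    have hset : (A ∪ o.pre T) \ (o.pre T \ G.parents A) = A ∪ G.parents A := by
      rw [Finset.union_sdiff_distrib, Finset.sdiff_sdiff_eq_self hpa,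
        Finset.sdiff_eq_self_of_disjoint (hAB.mono_right hsub)]
    -- The non-parents are summed out of `p(A | pre) p(pre)`; the first factor ignores them and
    -- comes out of the sum.
    have hm := sumOver_marg p (hsub.trans (Finset.subset_union_right (s₁ := A))) i
    rw [hset, hmul, sumOver_mul_left h, sumOver_marg p hsub, Finset.sdiff_sdiff_eq_self hpa] at hm
    · rw [← hm, hmul]
      ring
    · intro v hv
      have hv' := Finset.mem_sdiff.1 hv
      simp [hv'.2, Finset.disjoint_right.1 hAB hv'.1]

variable [∀ v, NeZero (r v)]

theorem contrast_logCond_eq_zero (hβ : ∀ x, IsConstrained x → regParam o (logCond p) x = 0)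
    {T : G.Component} {A : Finset V} (hA : A ⊆ G.nodes T) (hne : A.Nonempty)
    (hconn : ¬ G.IsConn A) {i : Cell r} (hi : ∀ v ∈ A, i v ≠ 0) :
    contrast A (logCond p A (o.pre T)) i = 0 :=
  contrast_eq_zero_of_regParam_eq_zero o (A := ⟨A, hne, hA⟩) (dependsOn_logCond p _ _)
    (fun b iA ib => hβ ⟨T, ⟨A, hne, hA⟩, b, iA, ib⟩ (Or.inr hconn)) hi

theorem contrast_logCond_eq_of_agree (hβ : ∀ x, IsConstrained x → regParam o (logCond p) x = 0)
    {T : G.Component} {A : Finset V} (hA : A ⊆ G.nodes T) (hne : A.Nonempty)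
    {i j : Cell r} (hi : ∀ v ∈ A, i v ≠ 0) (hij : ∀ v ∈ A, i v = j v)
    (hpa : ∀ v ∈ G.parents A, i v = j v) :
    contrast A (logCond p A (o.pre T)) i = contrast A (logCond p A (o.pre T)) j := by
  by_cases hconn : G.IsConn A
  · have hdep := dependsOn_logCond p A (o.pre T)
    rw [← glueContrast_eq_contrast hdep (iA := fun v => ⟨i v, hi v v.2⟩)
        (iB := fun v => i v) (fun _ => rfl) (fun _ => rfl),
      ← glueContrast_eq_contrast hdep (iA := fun v => ⟨i v, hi v v.2⟩)
        (iB := fun v => j v) (fun v => (hij v v.2).symm) (fun _ => rfl),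
      sum_baselineCoeff (glueContrast _ _ _ _), sum_baselineCoeff (glueContrast _ _ _ _)]
    refine Finset.sum_congr rfl fun b _ => ?_
    by_cases hb : b.1 ⊆ G.parents A
    · exact congrArg _ (funext fun v => hpa v (hb v.2))
    · have hz : ∀ ib, baselineCoeff (glueContrast (logCond p A (o.pre T)) A (o.pre T)
          fun v => ⟨i v, hi v v.2⟩) b.1 ib = 0 := fun ib =>
        hβ ⟨T, ⟨A, hne, hA⟩, ⟨b.1, Finset.mem_powerset.1 b.2⟩, _, ib⟩ (Or.inl ⟨hconn, hb⟩)
      rw [hz, hz]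
  · rw [contrast_logCond_eq_zero hβ hA hne hconn hi,
      contrast_logCond_eq_zero hβ hA hne hconn fun v hv => hij v hv ▸ hi v hv]

theorem condProb_eq_of_agree (hp : ∀ i, 0 < p i)
    (hβ : ∀ x, IsConstrained x → regParam o (logCond p) x = 0)
    {T : G.Component} {A : Finset V} (hA : A ⊆ G.nodes T) {k k' : Cell r}
    (hk : ∀ v ∈ A, k v = k' v) (hpa : ∀ v ∈ G.parents A, k v = k' v) :
    condProb p A (o.pre T) k = condProb p A (o.pre T) k' := by
  set B := o.pre T with hB
  have hAB : Disjoint A B := (o.disjoint_nodes_pre T).mono_left hA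
  -- `mix B k` freezes the past at `k`, so both tables are functions of the response coordinates
  -- alone. For every `C ⊆ A` the contrast sees at most the parents of `C`, which are parents of
  -- `A`, and there the two pasts agree.
  have key := eq_zero_of_contrast_eq_zero (A := A)
    (d := fun C j => condProb p C B (mix B k j) - condProb p C B (mix B k' j))
    (l := fun C j => logCond p C B (mix B k j) - logCond p C B (mix B k' j))
    (fun C hC D hD i => by
      have hCB := hAB.mono_left hC
      rw [sumOver_sub, sumOver_comp_mix (hCB.mono_left hD), sumOver_comp_mix (hCB.mono_left hD),
        sumOver_condProb p hCB hD, sumOver_condProb p hCB hD])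
    (fun i => by simp [condProb_empty hp])
    (fun C hC hne i hi => by
      have hCB := hAB.mono_left hC
      have hmix : ∀ (k : Cell r), ∀ v ∈ C, mix B k i v = i v := fun k v hv => by
        simp [mix, Finset.disjoint_left.1 hCB hv]
      rw [contrast_sub, contrast_comp_mix hCB, contrast_comp_mix hCB, sub_eq_zero]
      refine contrast_logCond_eq_of_agree hβ (hC.trans hA) hne ?_ ?_ ?_
      · intro v hv
        rw [hmix k v hv]
        exact hi v hv
      · intro v hv
        rw [hmix k v hv, hmix k' v hv]
      · intro v hv
        have hvA := parents_subset_parents hA hC hv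
        have hvB : v ∈ B := parents_subset_pre o hA hvA
        simp [mix, hvB, hpa v hvA])
    (fun C _ i h => sub_mul_log_sub_log_pos (condProb_pos hp _ _ _) (condProb_pos hp _ _ _) h)
    A subset_rfl k
  rw [sub_eq_zero] at key
  convert key using 1
  · refine dependsOn_condProb p A B fun v _ => ?_
    by_cases hv : v ∈ B <;> simp [mix, hv]
  · refine dependsOn_condProb p A B fun v hv => ?_
    by_cases hvB : v ∈ B
    · simp [mix, hvB]
    · have hvA : v ∈ A := by simpa [hvB] using hv
      simp [mix, hvB, hk v hvA]

theorem condProb_union_of_separated (hp : ∀ i, 0 < p i)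
    (hβ : ∀ x, IsConstrained x → regParam o (logCond p) x = 0)
    {T : G.Component} {A₁ A₂ : Finset V} (hA₁ : A₁ ⊆ G.nodes T) (hA₂ : A₂ ⊆ G.nodes T)
    (hd : Disjoint A₁ A₂) (hsep : ∀ v ∈ A₁, ∀ w ∈ A₂, ¬ G.undir.Adj v w) (i : Cell r) :
    condProb p (A₁ ∪ A₂) (o.pre T) i = condProb p A₁ (o.pre T) i * condProb p A₂ (o.pre T) i := by
  set B := o.pre T with hB
  have hT := o.disjoint_nodes_pre T
  have hA : A₁ ∪ A₂ ⊆ G.nodes T := Finset.union_subset hA₁ hA₂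
  have hdep : ∀ {C S S' : Finset V} {v : V}, C ⊆ A₁ ∪ A₂ → v ∈ C → v ∈ S → Disjoint S' S →
      ∀ i, contrast C (logCond p (C ∩ S') B) i = 0 := by
    intro C S S' v hC hvC hvS hSS' i
    refine contrast_eq_zero_of_dependsOn (dependsOn_logCond p _ _) hvC ?_ i
    have : v ∉ B := Finset.disjoint_left.1 hT (hA (hC hvC))
    simp [Finset.disjoint_right.1 hSS' hvS, this]
  have key := eq_zero_of_contrast_eq_zero (A := A₁ ∪ A₂)
    (d := fun C j => condProb p C B j - condProb p (C ∩ A₁) B j * condProb p (C ∩ A₂) B j)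
    (l := fun C j => logCond p C B j - (logCond p (C ∩ A₁) B j + logCond p (C ∩ A₂) B j))
    (fun C hC D hD i => by
      have hCB : Disjoint C B := hT.mono_left (hC.trans hA)
      have hDu : D = (D ∩ A₁) ∪ (D ∩ A₂) := by
        rw [← Finset.inter_union_distrib_left, Finset.inter_eq_left.2 (hD.trans hC)]
      have hs : ∀ S : Finset V, (C ∩ S) \ (D ∩ S) = (C \ D) ∩ S := fun S => by
        ext v
        simp only [Finset.mem_sdiff, Finset.mem_inter]
        tauto
      have hmul : sumOver D (fun j => condProb p (C ∩ A₁) B j * condProb p (C ∩ A₂) B j) i =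
          condProb p ((C \ D) ∩ A₁) B i * condProb p ((C \ D) ∩ A₂) B i := by
        conv_lhs => rw [hDu]
        rw [sumOver_condProb_mul p (hd.mono Finset.inter_subset_right Finset.inter_subset_right)
          (hCB.mono_left Finset.inter_subset_left) (hCB.mono_left Finset.inter_subset_left)
          (Finset.inter_subset_inter_right hD) (Finset.inter_subset_inter_right hD), hs, hs]
      rw [sumOver_sub, sumOver_condProb p hCB hD, hmul])
    (fun i => by simp [condProb_empty hp])
    (fun C hC hne i hi => by
      -- If `C` meets both sides it is disconnected, so its own contrast is zero, and each factor of
      -- the product ignores a coordinate of `C`. If `C` lies on one side, the product is `p(C)`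
      -- itself and `l C` is zero.
      by_cases h₁ : ∃ v ∈ C, v ∈ A₁
      · obtain ⟨v, hvC, hv⟩ := h₁
        by_cases h₂ : ∃ w ∈ C, w ∈ A₂
        · obtain ⟨w, hwC, hw⟩ := h₂
          have hadd : contrast C (fun j => logCond p C B j -
              (logCond p (C ∩ A₁) B j + logCond p (C ∩ A₂) B j)) i =
              contrast C (logCond p C B) i - (contrast C (logCond p (C ∩ A₁) B) i +
                contrast C (logCond p (C ∩ A₂) B) i) := by
            simp only [contrast, mul_sub, mul_add, Finset.sum_sub_distrib, Finset.sum_add_distrib]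
          rw [hadd, contrast_logCond_eq_zero hβ (hC.trans hA) hne
            (not_isConn_of_separated hd hsep hC hvC hv hwC hw) hi, hdep hC hwC hw hd,
            hdep hC hvC hv hd.symm]
          norm_num
        · have hC₁ : C ∩ A₁ = C := Finset.inter_eq_left.2 fun w hw =>
            (Finset.mem_union.1 (hC hw)).resolve_right fun h => h₂ ⟨w, hw, h⟩
          have hC₂ : C ∩ A₂ = ∅ := Finset.eq_empty_of_forall_notMem fun w hw =>
            h₂ ⟨w, (Finset.mem_inter.1 hw).1, (Finset.mem_inter.1 hw).2⟩
          simp [hC₁, hC₂, contrast, logCond, condProb_empty hp]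
      · have hC₂ : C ∩ A₂ = C := Finset.inter_eq_left.2 fun w hw =>
          (Finset.mem_union.1 (hC hw)).resolve_left fun h => h₁ ⟨w, hw, h⟩
        have hC₁ : C ∩ A₁ = ∅ := Finset.eq_empty_of_forall_notMem fun w hw =>
          h₁ ⟨w, (Finset.mem_inter.1 hw).1, (Finset.mem_inter.1 hw).2⟩
        simp [hC₁, hC₂, contrast, logCond, condProb_empty hp])
    (fun C _ i h => by
      have h₁ := condProb_pos hp (C ∩ A₁) B i
      have h₂ := condProb_pos hp (C ∩ A₂) B i
      have := sub_mul_log_sub_log_pos (condProb_pos hp C B i) (mul_pos h₁ h₂) h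
      rwa [Real.log_mul h₁.ne' h₂.ne'] at this)
    (A₁ ∪ A₂) subset_rfl i
  rw [sub_eq_zero] at key
  rwa [Finset.inter_eq_right.2 Finset.subset_union_left,
    Finset.inter_eq_right.2 Finset.subset_union_right] at key

/-- The pieces are split off one at a time; no edge joins a piece to the union of the others. -/
theorem mutualCondIndep_of_regParam_eq_zero (hp : ∀ i, 0 < p i)
    (hβ : ∀ x, IsConstrained x → regParam o (logCond p) x = 0)
    {T : G.Component} {A : Finset V} (hA : A ⊆ G.nodes T) :
    MutualCondIndep p (G.pieces A) (o.pre T) := by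
  intro i
  have key : ∀ S ⊆ G.pieces A,
      condProb p (S.biUnion id) (o.pre T) i = ∏ K ∈ S, condProb p K (o.pre T) i := by
    intro S
    induction S using Finset.induction_on with
    | empty => simp [condProb_empty hp]
    | insert K S hKS ih =>
      intro hS
      have hK := hS (Finset.mem_insert_self K S)
      have hS' : S ⊆ G.pieces A := (Finset.subset_insert K S).trans hS
      have hne : ∀ {v w : V}, v ∈ K → w ∈ S.biUnion id → ¬ G.JoinedIn A v w := by
        intro v w hv hw h
        obtain ⟨K', hK', hwK'⟩ := Finset.mem_biUnion.1 hw
        exact hKS (eq_of_joinedIn_of_mem_pieces hK (hS' hK') hv hwK' h ▸ hK')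
      have hU : S.biUnion id ⊆ A :=
        Finset.biUnion_subset.2 fun K' hK' => subset_of_mem_pieces (hS' hK')
      have hKA := subset_of_mem_pieces hK
      rw [Finset.biUnion_insert, Finset.prod_insert hKS, ← ih hS']
      refine condProb_union_of_separated hp hβ (hKA.trans hA) (hU.trans hA) ?_ ?_ i
      · exact Finset.disjoint_left.2 fun v hv hv' => hne hv hv' (ChainGraph.JoinedIn.refl (hKA hv))
      · exact fun v hv w hw h => hne hv hw (ChainGraph.JoinedIn.of_adj (hKA hv) (hU hw) h)
  exact key _ subset_rfl

theorem mrMarkov_of_regParam_eq_zero (hp : ∀ i, 0 < p i)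
    (hβ : ∀ x, IsConstrained x → regParam o (logCond p) x = 0) : MRMarkov G o p := by
  refine fun T A hA => ⟨fun _ => (condIndep_parents_iff hp hA).2 fun i j hij => ?_,
    fun _ => mutualCondIndep_of_regParam_eq_zero hp hβ hA⟩
  exact condProb_eq_of_agree hp hβ hA (fun v hv => hij v (by simp [hv]))
    fun v hv => hij v (by simp [hv])

theorem regParam_eq_zero_of_mrMarkov (hp : ∀ i, 0 < p i) (h : MRMarkov G o p)
    (x : ParamIndex o r) (hx : IsConstrained x) : regParam o (logCond p) x = 0 := by
  obtain ⟨T, ⟨A, hne, hA⟩, ⟨b, hb⟩, iA, ib⟩ := x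
  have hAB : Disjoint A (o.pre T) := (o.disjoint_nodes_pre T).mono_left hA
  by_cases hconn : G.IsConn A
  · have hbpa : ¬ b ⊆ G.parents A := by
      rcases hx with hx | hx
      · exact hx.2
      · exact absurd hconn hx
    -- The contrast, as a function of the past, ignores this non-parent `v ∈ b`, so its coefficient
    -- at `b` vanishes.
    obtain ⟨v, hvb, hv⟩ := Finset.not_subset.1 hbpa
    have hdep := (condIndep_parents_iff hp hA).1 ((h T A hA).1 hconn)
    unfold regParam baselineCoeff
    refine contrast_eq_zero_of_dependsOn (r := r) (S := (G.parents A : Set V)) (fun i j hij => ?_)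
      hvb (by simpa using hv) _
    refine Finset.sum_congr rfl fun s _ => congrArg _ (congrArg Real.log (hdep fun w hw => ?_))
    by_cases hwA : w ∈ A
    · simp [glue, hwA]
    · have hw' : w ∈ G.parents A := by simpa [hwA] using hw
      simp [glue, hwA, hij w (by simpa using hw')]
  · have hmut := (h T A hA).2 hconn
    refine Finset.sum_eq_zero fun D _ => mul_eq_zero_of_right _ ?_
    refine (glueContrast_eq_contrast_glue (dependsOn_logCond p _ _) hAB _ _).trans ?_
    dsimp only
    -- Independence makes the logarithm additive over the pieces, and each piece misses a node of
    -- the disconnected set `A`.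
    have hlog : logCond p A (o.pre T) =
        fun j => ∑ K ∈ G.pieces A, logCond p K (o.pre T) j := by
      funext j
      have := hmut j
      rw [biUnion_pieces] at this
      rw [logCond, this, Real.log_prod fun K _ => (condProb_pos hp _ _ _).ne']
      rfl
    rw [hlog, contrast_sum]
    refine Finset.sum_eq_zero fun K hK => ?_
    obtain ⟨v, hvA, hvK⟩ := exists_mem_notMem_of_mem_pieces hconn hK
    refine contrast_eq_zero_of_dependsOn (dependsOn_logCond p _ _) hvA ?_ _
    simp [hvK, Finset.disjoint_left.1 hAB hvA]

theorem mem_modelMR_iff (hp : IsPositiveDist p) :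
    p ∈ modelMR G o r ↔ ∀ x, IsConstrained x → regParam o (logCond p) x = 0 :=
  ⟨fun h => regParam_eq_zero_of_mrMarkov hp.1 h.2,
    fun h => ⟨hp, mrMarkov_of_regParam_eq_zero hp.1 h⟩⟩

end Markov

/-! ### Recovering a distribution, and a tangent vector, from the parameters. -/

section Recovery

open ChainGraph

variable {V : Type*} [Fintype V] [DecidableEq V] {r : V → ℕ}

/-- The derivative of `logCond p A B` in the direction `u`. -/
noncomputable def tangentCond (p u : Cell r → ℝ) (A B : Finset V) (i : Cell r) : ℝ :=
  marg u (A ∪ B) i / marg p (A ∪ B) i - marg u B i / marg p B i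

theorem dependsOn_tangentCond (p u : Cell r → ℝ) (A B : Finset V) :
    DependsOn (tangentCond p u A B) ((A ∪ B : Finset V) : Set V) := by
  intro i j h
  have hB : ∀ v ∈ (B : Set V), i v = j v := fun v hv => h v (by simp_all)
  unfold tangentCond
  rw [dependsOn_marg p _ h, dependsOn_marg u _ h, dependsOn_marg p _ hB, dependsOn_marg u _ hB]

theorem sumOver_condProb_mul_tangentCond {p : Cell r → ℝ} (hp : ∀ i, 0 < p i) (u : Cell r → ℝ)
    {A B D : Finset V} (hAB : Disjoint A B) (hD : D ⊆ A) (i : Cell r) :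
    sumOver D (fun j => condProb p A B j * tangentCond p u A B j) i =
      condProb p (A \ D) B i * tangentCond p u (A \ D) B i := by
  have hformula : ∀ (C : Finset V) (j : Cell r), condProb p C B j * tangentCond p u C B j =
      (marg p B j)⁻¹ * marg u (C ∪ B) j - marg u B j / marg p B j * condProb p C B j := by
    intro C j
    have h₁ := (marg_pos hp B j).ne'
    have h₂ := (marg_pos hp (C ∪ B) j).ne'
    unfold condProb tangentCond
    field_simp
  have hDB : ∀ v ∈ D, v ∉ (B : Set V) := fun v hv hvB =>
    Finset.disjoint_left.1 hAB (hD hv) (by simpa using hvB)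
  have hinv : DependsOn (fun j => (marg p B j)⁻¹) (B : Set V) := fun x y h =>
    congrArg (·⁻¹) (dependsOn_marg p B h)
  have hdiv : DependsOn (fun j => marg u B j / marg p B j) (B : Set V) := fun x y h =>
    congrArg₂ (· / ·) (dependsOn_marg u B h) (dependsOn_marg p B h)
  simp_rw [hformula]
  rw [sumOver_sub, sumOver_mul_left hinv hDB, sumOver_mul_left hdiv hDB,
    sumOver_condProb p hAB hD, sumOver_marg u (hD.trans Finset.subset_union_left),
    Finset.union_sdiff_distrib, Finset.sdiff_eq_self_of_disjoint (hAB.mono_left hD).symm]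

theorem marg_empty (p : Cell r → ℝ) (i : Cell r) : marg p ∅ i = ∑ j, p j := by
  simp [marg]

variable [∀ v, NeZero (r v)] {G : ChainGraph V} {o : G.ConsistentOrder}

theorem condProb_eq_of_regParam_eq {p p' : Cell r → ℝ} (hp : ∀ i, 0 < p i) (hp' : ∀ i, 0 < p' i)
    (h : ∀ x : ParamIndex o r, regParam o (logCond p) x = regParam o (logCond p') x)
    (T : G.Component) (i : Cell r) :
    condProb p (G.nodes T) (o.pre T) i = condProb p' (G.nodes T) (o.pre T) i := by
  have hT := o.disjoint_nodes_pre T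
  refine sub_eq_zero.1 (eq_zero_of_contrast_eq_zero (A := G.nodes T)
    (d := fun C j => condProb p C (o.pre T) j - condProb p' C (o.pre T) j)
    (l := fun C j => logCond p C (o.pre T) j - logCond p' C (o.pre T) j)
    (fun C hC D hD i => ?_) (fun i => ?_) (fun C hC hne i hi => ?_) (fun C _ i hi => ?_)
    _ subset_rfl i)
  · rw [sumOver_sub, sumOver_condProb p (hT.mono_left hC) hD,
      sumOver_condProb p' (hT.mono_left hC) hD]
  · simp [condProb_empty hp, condProb_empty hp']
  · refine contrast_eq_zero_of_regParam_eq_zero o (A := ⟨C, hne, hC⟩)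
      (F := fun A B i => logCond p A B i - logCond p' A B i) (fun x y hxy => ?_)
      (fun b iA ib => ?_) hi
    · exact congrArg₂ (· - ·) (dependsOn_logCond p _ _ hxy) (dependsOn_logCond p' _ _ hxy)
    · rw [regParam_sub, h, sub_self]
  · exact sub_mul_log_sub_log_pos (condProb_pos hp _ _ _) (condProb_pos hp' _ _ _) hi

theorem tangentCond_eq_zero_of_regParam_eq_zero {p u : Cell r → ℝ} (hp : ∀ i, 0 < p i)
    (h : ∀ x : ParamIndex o r, regParam o (tangentCond p u) x = 0)
    (T : G.Component) (i : Cell r) : tangentCond p u (G.nodes T) (o.pre T) i = 0 := by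
  have hT := o.disjoint_nodes_pre T
  have key := eq_zero_of_contrast_eq_zero (A := G.nodes T)
    (d := fun C j => condProb p C (o.pre T) j * tangentCond p u C (o.pre T) j)
    (l := fun C j => tangentCond p u C (o.pre T) j)
    (fun C hC D hD i => sumOver_condProb_mul_tangentCond hp u (hT.mono_left hC) hD i)
    (fun i => by simp [tangentCond])
    (fun C hC hne i hi => contrast_eq_zero_of_regParam_eq_zero o (A := ⟨C, hne, hC⟩)
      (dependsOn_tangentCond p u _ _) (fun b iA ib => h _) hi)
    (fun C _ i hi => by
      have h₁ := condProb_pos hp C (o.pre T) i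
      have h₂ : 0 < tangentCond p u C (o.pre T) i * tangentCond p u C (o.pre T) i :=
        mul_self_pos.2 (right_ne_zero_of_mul hi)
      rw [mul_assoc]
      exact mul_pos h₁ h₂)
    _ subset_rfl i
  exact (mul_eq_zero.1 key).resolve_left (condProb_pos hp _ _ _).ne'

/-- The conditionals of the components are multiplied along the order. The totals stay in the
identity because it is applied to unnormalized weights. -/
theorem mul_sum_eq_of_regParam_eq {p p' : Cell r → ℝ} (hp : ∀ i, 0 < p i) (hp' : ∀ i, 0 < p' i)
    (h : ∀ x : ParamIndex o r, regParam o (logCond p) x = regParam o (logCond p') x)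
    (i : Cell r) : p i * ∑ j, p' j = p' i * ∑ j, p j := by
  have key := o.induction_univ
    (P := fun S => marg p S i * ∑ j, p' j = marg p' S i * ∑ j, p j)
    (by rw [marg_empty, marg_empty, mul_comm]) fun T ih => by
      have hc := condProb_eq_of_regParam_eq hp hp' h T i
      rw [condProb, condProb, div_eq_div_iff (marg_pos hp _ _).ne' (marg_pos hp' _ _).ne'] at hc
      refine mul_right_cancel₀ (marg_pos hp' (o.pre T) i).ne' ?_
      linear_combination (∑ j, p' j) * hc + marg p' (G.nodes T ∪ o.pre T) i * ih
  simpa only [marg_univ] using key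

theorem mul_sum_eq_of_regParam_tangentCond {p u : Cell r → ℝ} (hp : ∀ i, 0 < p i)
    (h : ∀ x : ParamIndex o r, regParam o (tangentCond p u) x = 0)
    (i : Cell r) : u i * ∑ j, p j = p i * ∑ j, u j := by
  have key := o.induction_univ
    (P := fun S => marg u S i * ∑ j, p j = marg p S i * ∑ j, u j)
    (by rw [marg_empty, marg_empty, mul_comm]) fun T ih => by
      have hc := tangentCond_eq_zero_of_regParam_eq_zero hp h T i
      rw [tangentCond, sub_eq_zero,
        div_eq_div_iff (marg_pos hp _ _).ne' (marg_pos hp _ _).ne'] at hc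
      refine mul_right_cancel₀ (marg_pos hp (o.pre T) i).ne' ?_
      linear_combination (∑ j, p j) * hc + marg p (G.nodes T ∪ o.pre T) i * ih
  simpa only [marg_univ] using key

end Recovery

/-! ### Linear sections in global coordinates. -/

section Submanifold

variable {E F : Type*} [NormedAddCommGroup E] [NormedSpace ℝ E] [NormedAddCommGroup F]
  [NormedSpace ℝ F]

/-- The preimage of a linear subspace under a diffeomorphism onto an open set is a smooth
submanifold. -/
theorem isSmoothSubmanifold_preimage (Φ : OpenPartialHomeomorph E F)
    (hsource : Φ.source = Set.univ) (hΦ : ContDiff ℝ ∞ Φ)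
    (hsymm : ContDiffOn ℝ ∞ Φ.symm Φ.target) (L : F ≃L[ℝ] E) (W : Submodule ℝ F) :
    IsSmoothSubmanifold {x | Φ x ∈ W} := by
  -- Charts must map `E` to itself, so `L` carries the coordinate space and `W` back to `E`.
  refine ⟨W.comap L.symm.toLinearMap, fun x _ =>
    ⟨Φ.transHomeomorph L.toHomeomorph, ?_, ?_, ?_, fun y _ => ?_⟩⟩
  · exact hsource ▸ Set.mem_univ x
  · exact (L.contDiff.comp hΦ).contDiffOn
  · exact hsymm.comp L.symm.contDiff.contDiffOn fun _ h => h
  · change _ ↔ L.symm (L (Φ y)) ∈ W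
    rw [L.symm_apply_apply]
    rfl

end Submanifold

/-! ### The parameter map on the natural parameter space. -/

section ExponentialFamily

variable {V : Type*} [Fintype V] {r : V → ℕ} [∀ v, NeZero (r v)]

/-- The unnormalized density of the exponential family. -/
noncomputable def expWeight (θ : NatParam r) (i : Cell r) : ℝ := Real.exp (natScore θ i)

theorem expWeight_pos (θ : NatParam r) (i : Cell r) : 0 < expWeight θ i := Real.exp_pos _

theorem natScore_zero_cell (θ : NatParam r) : natScore θ (fun _ => 0) = 0 := by
  simp [natScore]

theorem natScore_coe (θ : NatParam r) (i : {i : Cell r // i ≠ fun _ => 0}) :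
    natScore θ i.1 = θ i := dif_pos i.2

theorem natParam_ext {θ θ' : NatParam r} (h : ∀ i, natScore θ i = natScore θ' i) : θ = θ' :=
  funext fun i => (natScore_coe θ i).symm.trans ((h i.1).trans (natScore_coe θ' i))

theorem natScore_add_smul (θ h : NatParam r) (t : ℝ) (i : Cell r) :
    natScore (θ + t • h) i = natScore θ i + t * natScore h i := by
  by_cases hi : i ≠ fun _ => 0
  · simp [natScore, hi]
  · simp [natScore, hi]

variable [DecidableEq V]

theorem sum_expWeight_pos (θ : NatParam r) : 0 < ∑ j, expWeight θ j :=
  Finset.sum_pos (fun j _ => expWeight_pos θ j) Finset.univ_nonempty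

theorem expDist_eq (θ : NatParam r) (i : Cell r) :
    expDist θ i = expWeight θ i / ∑ j, expWeight θ j := by
  change Real.exp (natScore θ i - Real.log (∑ j, expWeight θ j)) = _
  rw [Real.exp_sub, Real.exp_log (sum_expWeight_pos θ), expWeight]

theorem isPositiveDist_expDist (θ : NatParam r) : IsPositiveDist (expDist θ) := by
  refine ⟨fun i => Real.exp_pos _, ?_⟩
  simp_rw [expDist_eq]
  rw [← Finset.sum_div, div_self (sum_expWeight_pos θ).ne']

theorem exists_expDist_eq {p : Cell r → ℝ} (hp : IsPositiveDist p) :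
    ∃ θ : NatParam r, expDist θ = p := by
  refine ⟨fun i => Real.log (p i.1 / p fun _ => 0), ?_⟩
  have h₀ := hp.1 fun _ => 0
  have hw : ∀ i, expWeight (fun i : {i : Cell r // i ≠ fun _ => 0} =>
      Real.log (p i.1 / p fun _ => 0)) i = p i / p fun _ => 0 := by
    intro i
    by_cases hi : i = fun _ => 0
    · rw [hi, expWeight, natScore_zero_cell, Real.exp_zero, div_self h₀.ne']
    · rw [expWeight, natScore_coe _ ⟨i, hi⟩, Real.exp_log (div_pos (hp.1 _) h₀)]
  funext i
  rw [expDist_eq]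
  simp_rw [hw]
  rw [← Finset.sum_div, hp.2]
  field_simp

/-- The normalizing constant cancels in conditionals, so the log-partition function never has to be
differentiated. -/
theorem logCond_expDist (θ : NatParam r) : logCond (expDist θ) = logCond (expWeight θ) := by
  have hm : ∀ (B : Finset V) (i : Cell r),
      marg (expDist θ) B i = marg (expWeight θ) B i / ∑ j, expWeight θ j := by
    intro B i
    unfold marg
    simp_rw [expDist_eq]
    rw [Finset.sum_div]
  funext A B i
  rw [logCond, logCond, condProb, condProb, hm, hm,
    div_div_div_cancel_right₀ (sum_expWeight_pos θ).ne']

variable {G : ChainGraph V} (o : G.ConsistentOrder)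

/-- The regression parameters as functions of the natural parameters. -/
noncomputable def paramMap (θ : NatParam r) (x : FreeIndex o r) : ℝ :=
  regParam o (logCond (expWeight θ)) x.1

theorem contDiff_natScore (i : Cell r) : ContDiff ℝ ∞ fun θ : NatParam r => natScore θ i := by
  by_cases hi : i ≠ fun _ => 0
  · simp only [natScore, hi, dif_pos, not_false_eq_true, ne_eq]
    exact contDiff_apply ℝ ℝ _
  · simp only [natScore, hi, dif_neg, not_false_eq_true]
    exact contDiff_const

theorem contDiff_logCond (A B : Finset V) (i : Cell r) :
    ContDiff ℝ ∞ fun θ : NatParam r => logCond (expWeight θ) A B i := by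
  have hm : ∀ B : Finset V, ContDiff ℝ ∞ fun θ : NatParam r => marg (expWeight θ) B i :=
    fun B => ContDiff.sum fun j _ => (contDiff_natScore j).exp
  exact ((hm _).div (hm _) fun θ => (marg_pos (expWeight_pos θ) _ _).ne').log
    fun θ => (condProb_pos (expWeight_pos θ) _ _ _).ne'

theorem contDiff_paramMap : ContDiff ℝ ∞ (paramMap o (r := r)) :=
  contDiff_pi.2 fun _ => ContDiff.sum fun _ _ => contDiff_const.mul <|
    ContDiff.sum fun _ _ => contDiff_const.mul <| contDiff_logCond _ _ _

theorem hasDerivAt_logCond (θ h : NatParam r) (A B : Finset V) (i : Cell r) :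
    HasDerivAt (fun t : ℝ => logCond (expWeight (θ + t • h)) A B i)
      (tangentCond (expWeight θ) (fun j => expWeight θ j * natScore h j) A B i) 0 := by
  have hw : ∀ j, HasDerivAt (fun t : ℝ => expWeight (θ + t • h) j)
      (expWeight θ j * natScore h j) 0 := by
    intro j
    have := (((hasDerivAt_id (0 : ℝ)).mul_const (natScore h j)).const_add (natScore θ j)).exp
    simpa [expWeight, natScore_add_smul] using this
  have hm : ∀ B : Finset V, HasDerivAt (fun t : ℝ => marg (expWeight (θ + t • h)) B i)
      (marg (fun j => expWeight θ j * natScore h j) B i) 0 :=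
    fun B => HasDerivAt.fun_sum fun j _ => hw j
  have hlog : ∀ B : Finset V, HasDerivAt (fun t : ℝ => Real.log (marg (expWeight (θ + t • h)) B i))
      (marg (fun j => expWeight θ j * natScore h j) B i / marg (expWeight θ) B i) 0 := by
    intro B
    have := (hm B).log (marg_pos (expWeight_pos _) _ _).ne'
    simpa only [zero_smul, add_zero] using this
  have hfun : (fun t : ℝ => logCond (expWeight (θ + t • h)) A B i) = fun t : ℝ =>
      Real.log (marg (expWeight (θ + t • h)) (A ∪ B) i) -
        Real.log (marg (expWeight (θ + t • h)) B i) := by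
    funext t
    rw [logCond, condProb, Real.log_div (marg_pos (expWeight_pos _) _ _).ne'
      (marg_pos (expWeight_pos _) _ _).ne']
  rw [hfun]
  exact (hlog _).sub (hlog _)

/-- `regParam` is a fixed linear combination of values of its family, so differentiation passes
through it. -/
theorem hasDerivAt_regParam (θ h : NatParam r) (x : ParamIndex o r) :
    HasDerivAt (fun t : ℝ => regParam o (logCond (expWeight (θ + t • h))) x)
      (regParam o (tangentCond (expWeight θ) fun j => expWeight θ j * natScore h j) x) 0 :=
  HasDerivAt.fun_sum fun _ _ => HasDerivAt.const_mul _ <|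
    HasDerivAt.fun_sum fun _ _ => HasDerivAt.const_mul _ <| hasDerivAt_logCond θ h _ _ _

theorem paramMap_injective : Function.Injective (paramMap o (r := r)) := by
  intro θ θ' h
  have hreg : ∀ x : ParamIndex o r,
      regParam o (logCond (expWeight θ)) x = regParam o (logCond (expWeight θ')) x := by
    intro x
    by_cases hx : ∀ v, x.2.2.2.2 v ≠ 0
    · exact congrFun h ⟨x, hx⟩
    · rw [regParam_eq_zero_of_coord o _ x hx, regParam_eq_zero_of_coord o _ x hx]
  have hmul := mul_sum_eq_of_regParam_eq (expWeight_pos θ) (expWeight_pos θ') hreg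
  -- The reference cell has weight 1 under every parameter, which equates the two totals.
  have h₀ := hmul fun _ => 0
  simp only [expWeight, natScore_zero_cell, Real.exp_zero, one_mul] at h₀
  refine natParam_ext fun i => Real.exp_injective ?_
  have hi := hmul i
  simp only [expWeight] at hi
  rw [h₀] at hi
  exact mul_right_cancel₀ (sum_expWeight_pos θ).ne' hi

/-- A kernel direction `h` makes the weight derivative proportional to the weight, so its score is
constant; the score is 0 at the reference cell, hence everywhere. -/
theorem fderiv_paramMap_injective (θ : NatParam r) :
    Function.Injective (fderiv ℝ (paramMap o) θ) := by
  refine (injective_iff_map_eq_zero _).2 fun h hh => ?_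
  have hline : HasDerivAt (fun t : ℝ => paramMap o (θ + t • h)) (fderiv ℝ (paramMap o) θ h) 0 :=
    (((contDiff_paramMap o).differentiable (by simp)) θ).hasFDerivAt.hasLineDerivAt h
  rw [hh, hasDerivAt_pi] at hline
  have hreg : ∀ x : ParamIndex o r,
      regParam o (tangentCond (expWeight θ) fun j => expWeight θ j * natScore h j) x = 0 := by
    intro x
    by_cases hx : ∀ v, x.2.2.2.2 v ≠ 0
    · exact (hasDerivAt_regParam o θ h x).unique (hline ⟨x, hx⟩)
    · exact regParam_eq_zero_of_coord o _ x hx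
  have hmul := mul_sum_eq_of_regParam_tangentCond (expWeight_pos θ) hreg
  have h₀ := hmul fun _ => 0
  simp only [natScore_zero_cell, mul_zero, zero_mul] at h₀
  have hsum := (mul_eq_zero.1 h₀.symm).resolve_left (expWeight_pos θ _).ne'
  refine natParam_ext fun i => ?_
  have hi := hmul i
  rw [hsum, mul_zero] at hi
  have := (mul_eq_zero.1 ((mul_eq_zero.1 hi).resolve_right (sum_expWeight_pos θ).ne')).resolve_left
    (expWeight_pos θ i).ne'
  rw [this]
  simp [natScore]

/-- The cell with the coordinates of a free parameter, and the first level elsewhere. -/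
def FreeIndex.cell {o : G.ConsistentOrder} (x : FreeIndex o r) : Cell r :=
  glue x.1.2.1.1 x.1.2.2.2.1 x.1.2.2.2.2

theorem FreeIndex.cell_ne_zero_iff {o : G.ConsistentOrder} (x : FreeIndex o r) (v : V) :
    x.cell v ≠ 0 ↔ v ∈ x.1.2.1.1 ∨ v ∈ x.1.2.2.1.1 := by
  by_cases hA : v ∈ x.1.2.1.1
  · simp [FreeIndex.cell, glue, hA, (x.1.2.2.2.1 ⟨v, hA⟩).2]
  · by_cases hb : v ∈ x.1.2.2.1.1
    · simp [FreeIndex.cell, glue, hA, hb, x.2 ⟨v, hb⟩]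
    · simp [FreeIndex.cell, glue, hA, hb]

theorem FreeIndex.prec_of_cell_eq {o : G.ConsistentOrder} {x y : FreeIndex o r}
    (h : x.cell = y.cell) : x.1.1 = y.1.1 ∨ o.prec y.1.1 x.1.1 := by
  obtain ⟨v, hv⟩ := x.1.2.1.2.1
  have hvT := ChainGraph.mem_nodes.1 (x.1.2.1.2.2 hv)
  have hvx := (x.cell_ne_zero_iff v).2 (Or.inl hv)
  rw [h, y.cell_ne_zero_iff] at hvx
  rcases hvx with hvy | hvy
  · exact Or.inl (hvT ▸ ChainGraph.mem_nodes.1 (y.1.2.1.2.2 hvy))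
  · exact Or.inr (hvT ▸ ChainGraph.ConsistentOrder.mem_pre.1 (y.1.2.2.1.2 hvy))

/-- The non-baseline support of the cell is `A ∪ b`. Its `≺`-least component is `T`, and
intersecting with `T` and `pre(T)` recovers `A` and `b`; the levels are then read off. -/
theorem FreeIndex.cell_injective (o : G.ConsistentOrder) :
    Function.Injective (FreeIndex.cell (o := o) (r := r)) := by
  intro x y h
  have hT : x.1.1 = y.1.1 := by
    rcases FreeIndex.prec_of_cell_eq h with h₁ | h₁
    · exact h₁
    rcases FreeIndex.prec_of_cell_eq h.symm with h₂ | h₂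
    · exact h₂.symm
    exact absurd (o.trans _ _ _ h₁ h₂) (o.irrefl _)
  have hsupp : ∀ v, (v ∈ x.1.2.1.1 ∨ v ∈ x.1.2.2.1.1) ↔ (v ∈ y.1.2.1.1 ∨ v ∈ y.1.2.2.1.1) :=
    fun v => by rw [← x.cell_ne_zero_iff, ← y.cell_ne_zero_iff, h]
  obtain ⟨⟨T, ⟨A, hne, hA⟩, ⟨b, hb⟩, iA, ib⟩, hx⟩ := x
  obtain ⟨⟨T', ⟨A', hne', hA'⟩, ⟨b', hb'⟩, iA', ib'⟩, hy⟩ := y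
  dsimp only at hT hsupp
  subst hT
  have hdisj : ∀ {v}, v ∈ G.nodes T → v ∉ o.pre T := fun hv =>
    Finset.disjoint_left.1 (o.disjoint_nodes_pre T) hv
  have hAA' : A = A' := by
    ext v
    exact ⟨fun hv => ((hsupp v).1 (Or.inl hv)).resolve_right fun h => hdisj (hA hv) (hb' h),
      fun hv => ((hsupp v).2 (Or.inl hv)).resolve_right fun h => hdisj (hA' hv) (hb h)⟩
  have hbb' : b = b' := by
    ext v
    exact ⟨fun hv => ((hsupp v).1 (Or.inr hv)).resolve_left fun h => hdisj (hA' h) (hb hv),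
      fun hv => ((hsupp v).2 (Or.inr hv)).resolve_left fun h => hdisj (hA h) (hb' hv)⟩
  subst hAA'
  subst hbb'
  have hcell : ∀ v, glue A iA ib v = glue A iA' ib' v := congrFun h
  have hiA : iA = iA' := by
    funext v
    have := hcell v
    simp only [glue, v.2, dif_pos, if_true] at this
    exact Subtype.ext this
  have hib : ib = ib' := by
    funext v
    have hvA : (v : V) ∉ A := fun hv => hdisj (hA hv) (hb v.2)
    have := hcell v
    simpa only [glue, v.2, hvA, dif_pos, dif_neg, not_false_eq_true] using this
  subst hiA
  subst hib
  rfl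

/-- One inequality comes from the injective derivative, the other from the injection of free
parameters into non-reference cells. Surjectivity of the cell map is never needed. -/
theorem finrank_natParam_eq :
    Module.finrank ℝ (NatParam r) = Module.finrank ℝ (FreeIndex o r → ℝ) := by
  refine le_antisymm (LinearMap.finrank_le_finrank_of_injective
    (f := (fderiv ℝ (paramMap o (r := r)) 0).toLinearMap) (fderiv_paramMap_injective o 0)) ?_
  rw [Module.finrank_fintype_fun_eq_card, Module.finrank_fintype_fun_eq_card]
  refine Fintype.card_le_of_injective
    (fun x : FreeIndex o r => (⟨x.cell, fun h => ?_⟩ : {i : Cell r // i ≠ fun _ => 0}))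
    fun x y h => FreeIndex.cell_injective o (congrArg Subtype.val h)
  obtain ⟨v, hv⟩ := x.1.2.1.2.1
  exact (x.cell_ne_zero_iff v).2 (Or.inl hv) (congrFun h v)

/-- The derivative of the parameter map as a linear equivalence. -/
noncomputable def fderivEquiv (θ : NatParam r) : NatParam r ≃L[ℝ] (FreeIndex o r → ℝ) :=
  (LinearMap.linearEquivOfInjective (fderiv ℝ (paramMap o) θ).toLinearMap
    (fderiv_paramMap_injective o θ) (finrank_natParam_eq o)).toContinuousLinearEquiv

theorem coe_fderivEquiv (θ : NatParam r) :
    (fderivEquiv o θ : NatParam r →L[ℝ] (FreeIndex o r → ℝ)) = fderiv ℝ (paramMap o) θ :=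
  rfl

/-- The derivative is invertible at every point, so the map is open by the inverse function theorem;
injectivity makes this global. -/
theorem isOpenEmbedding_paramMap : Topology.IsOpenEmbedding (paramMap o (r := r)) := by
  refine Topology.IsOpenEmbedding.of_continuous_injective_isOpenMap
    (contDiff_paramMap o).continuous (paramMap_injective o) ?_
  refine isOpenMap_iff_nhds_le.2 fun θ => ?_
  have h := (contDiff_paramMap o (r := r)).contDiffAt (x := θ) |>.hasStrictFDerivAt (by simp)
  rw [← coe_fderivEquiv] at h
  exact h.map_nhds_eq_of_equiv.ge

/-- The parameter map as a diffeomorphism onto an open set. -/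
noncomputable def paramHomeomorph : OpenPartialHomeomorph (NatParam r) (FreeIndex o r → ℝ) :=
  (isOpenEmbedding_paramMap o).toOpenPartialHomeomorph (paramMap o)

theorem contDiffOn_paramHomeomorph_symm :
    ContDiffOn ℝ ∞ (paramHomeomorph o (r := r)).symm (paramHomeomorph o (r := r)).target := by
  intro y hy
  refine ((paramHomeomorph o).contDiffAt_symm (f₀' := fderivEquiv o ((paramHomeomorph o).symm y))
    hy ?_ (contDiff_paramMap o).contDiffAt).contDiffWithinAt
  rw [coe_fderivEquiv]
  exact ((contDiff_paramMap o).differentiable (by simp) _).hasFDerivAt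

theorem modelMR_eq_image : modelMR G o r =
    expDist '' {θ | ∀ x : FreeIndex o r, IsConstrained x.1 → paramMap o θ x = 0} := by
  have hiff : ∀ θ : NatParam r, expDist θ ∈ modelMR G o r ↔
      ∀ x : FreeIndex o r, IsConstrained x.1 → paramMap o θ x = 0 := by
    intro θ
    rw [mem_modelMR_iff (isPositiveDist_expDist θ), logCond_expDist]
    refine ⟨fun h x hx => h x.1 hx, fun h x hx => ?_⟩
    -- Constrained parameters that are not free vanish by the baseline coding anyway.
    by_cases hfree : ∀ v, x.2.2.2.2 v ≠ 0
    · exact h ⟨x, hfree⟩ hx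
    · exact regParam_eq_zero_of_coord o _ x hfree
  ext p
  constructor
  · intro hp
    obtain ⟨θ, rfl⟩ := exists_expDist_eq hp.1
    exact ⟨θ, (hiff θ).1 hp, rfl⟩
  · rintro ⟨θ, hθ, rfl⟩
    exact (hiff θ).2 hθ

/-- The linear subspace of the parameters that satisfy the constraints. -/
def constrainedSubspace : Submodule ℝ (FreeIndex o r → ℝ) where
  carrier := {β | ∀ x, IsConstrained x.1 → β x = 0}
  add_mem' := fun hβ hγ x hx =>
    (congrArg₂ (· + ·) (hβ x hx) (hγ x hx)).trans (add_zero 0)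
  zero_mem' := fun _ _ => rfl
  smul_mem' := fun c _ hβ x hx => (congrArg (c * ·) (hβ x hx)).trans (mul_zero c)

theorem isSmoothSubmanifold_constrained :
    IsSmoothSubmanifold {θ : NatParam r | ∀ x : FreeIndex o r, IsConstrained x.1 →
      paramMap o θ x = 0} :=
  isSmoothSubmanifold_preimage (paramHomeomorph o) rfl (contDiff_paramMap o)
    (contDiffOn_paramHomeomorph_symm o)
    (ContinuousLinearEquiv.ofFinrankEq (finrank_natParam_eq o).symm) (constrainedSubspace o)

end ExponentialFamily

theorem theorem2 {V : Type*} [Fintype V] [DecidableEq V] (G : ChainGraph V)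
    (o : G.ConsistentOrder) (r : V → ℕ) [∀ v, NeZero (r v)] :
    -- the parameters of the saturated model are well defined
    (∀ p : Cell r → ℝ, IsPositiveDist p → ∃! β : ParamIndex o r → ℝ, IsSaturatedParam o p β) ∧
    -- the model is given by zero constraints on them
    (∀ (p : Cell r → ℝ) (β : ParamIndex o r → ℝ), IsPositiveDist p → IsSaturatedParam o p β →
      (p ∈ modelMR G o r ↔ ∀ x, IsConstrained x → β x = 0)) ∧
    -- they are a smooth parameterization, in which the model is defined by linear constraints
    (∃ Φ : OpenPartialHomeomorph (NatParam r) (FreeIndex o r → ℝ),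
      Φ.source = Set.univ ∧ ContDiffOn ℝ ∞ Φ Φ.source ∧ ContDiffOn ℝ ∞ Φ.symm Φ.target ∧
      (∀ θ β, IsSaturatedParam o (expDist θ) β → ∀ x : FreeIndex o r, Φ θ x = β x.1) ∧
      modelMR G o r =
        expDist '' {θ | ∀ x : FreeIndex o r, IsConstrained x.1 → Φ θ x = 0}) ∧
    IsCurvedExponentialFamily (modelMR G o r) := by
  refine ⟨fun p _ => ⟨regParam o (logCond p), (isSaturatedParam_iff o p _).2 rfl,
    fun β hβ => (isSaturatedParam_iff o p β).1 hβ⟩, fun p β hp hβ => ?_,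
    ⟨paramHomeomorph o, rfl, (contDiff_paramMap o).contDiffOn, contDiffOn_paramHomeomorph_symm o,
      fun θ β hβ x => ?_, modelMR_eq_image o⟩,
    ⟨_, isSmoothSubmanifold_constrained o, modelMR_eq_image o⟩⟩
  · rw [(isSaturatedParam_iff o p β).1 hβ]
    exact mem_modelMR_iff hp
  · rw [(isSaturatedParam_iff o _ β).1 hβ, logCond_expDist]
    rfl
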